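/- Let $n\ge 1$ and let $\mathcal M([0,1]^n)$ be the free $n$-generated MV-algebra of McNaughton functions, i.e. of all continuous $f\colon[0,1]^n\to[0,1]$ that agree at each point with one of finitely many affine functions with integer coefficients, with the pointwise operations $x\oplus y=\min(1,x+y)$, $\neg x=1-x$, $0$; let $\pi_1,\dots,\pi_n$ be the coordinate functions. A retraction of $\mathcal M([0,1]^n)$ onto a subalgebra $A$ is an idempotent endomorphism $\epsilon$ with range $A$; if one exists, $A$ is called a retract. A $\mathbb Z$-retract of $[0,1]^n$ is the range of a map $\sigma\colon[0,1]^n\to[0,1]^n$ with $\sigma\circ\sigma=\sigma$ all of whose components are McNaughton functions. For $Q\subseteq[0,1]^n$ let $\mathcal M(Q)$ be the MV-algebra of restrictions to $Q$ of the McNaughton functions on $[0,1]^n$. For every retract $A$ there is a $\mathbb Z$-retract $Q$ of $[0,1]^n$ with $A\cong\mathcal M(Q)$; it is homeomorphic to the maximal spectral space $\mu_A$ of $A$, and unique up to piecewise linear homeomorphisms with integer coefficients in both directions. We say that $\mu_A$ is a closed domain in $[0,1]^n$ if some (equivalently, every) such $Q$ is a closed domain in $[0,1]^n$, i.e. $Q=\operatorname{cl}(\operatorname{int}(Q))$,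 closure and interior being taken in $[0,1]^n$. **Theorem.** Let $A$ be a retract of $\mathcal M([0,1]^n)$ such that $\mu_A$ is a closed domain in $[0,1]^n$. Then the number $\mathsf r(A)$ of retractions of $\mathcal M([0,1]^n)$ onto $A$ is finite. Moreover, let $\epsilon$ be any retraction of $\mathcal M([0,1]^n)$ onto $A$, and let $R\subseteq[0,1]^n$ be the range of the map $(\epsilon(\pi_1),\dots,\epsilon(\pi_n))\colon[0,1]^n\to[0,1]^n$. Then the interior of $R$ in $[0,1]^n$ has finitely many connected components; if $k$ is their number and $\lambda$ is the least of their $n$-dimensional Lebesgue measures, then $\lambda>0$ and $$\mathsf r(A)\le\binom{\lfloor 1/\lambda\rfloor}{k}.$$ -/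

import Mathlib

open MeasureTheory Topology

/-- MV-algebras: `oplus` is `⊕`, `mneg` is the Łukasiewicz negation `¬`, `mzero` is `0`. -/
class MVAlgebra (A : Type*) where
  oplus : A → A → A
  mneg : A → A
  mzero : A
  oplus_assoc : ∀ x y z : A, oplus x (oplus y z) = oplus (oplus x y) z
  oplus_comm : ∀ x y : A, oplus x y = oplus y x
  oplus_mzero : ∀ x : A, oplus x mzero = x
  mneg_mneg : ∀ x : A, mneg (mneg x) = x
  oplus_mneg_mzero : ∀ x : A, oplus x (mneg mzero) = mneg mzero
  mneg_oplus_mneg_oplus : ∀ x y : A,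
    oplus (mneg (oplus (mneg x) y)) y = oplus (mneg (oplus (mneg y) x)) x

namespace MVAlgebra

/-- Homomorphisms of MV-algebras. -/
@[ext]
structure Hom (A B : Type*) [MVAlgebra A] [MVAlgebra B] where
  toFun : A → B
  map_mzero : toFun mzero = mzero
  map_mneg : ∀ x, toFun (mneg x) = mneg (toFun x)
  map_oplus : ∀ x y, toFun (oplus x y) = oplus (toFun x) (toFun y)

instance {A B : Type*} [MVAlgebra A] [MVAlgebra B] : CoeFun (Hom A B) (fun _ => A → B) :=
  ⟨Hom.toFun⟩

/-- Two MV-algebras are isomorphic: there is a bijective homomorphism between them. -/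
def Isomorphic (A B : Type*) [MVAlgebra A] [MVAlgebra B] : Prop :=
  ∃ f : Hom A B, Function.Bijective f

/-- Subalgebras of an MV-algebra. -/
structure Subalg (A : Type*) [MVAlgebra A] where
  carrier : Set A
  mzero_mem : mzero ∈ carrier
  mneg_mem : ∀ x ∈ carrier, mneg x ∈ carrier
  oplus_mem : ∀ x ∈ carrier, ∀ y ∈ carrier, oplus x y ∈ carrier

/-- A subalgebra is an MV-algebra under the restricted operations. -/
instance {A : Type*} [MVAlgebra A] (S : Subalg A) : MVAlgebra S.carrier where
  oplus x y := ⟨oplus x.1 y.1, S.oplus_mem _ x.2 _ y.2⟩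
  mneg x := ⟨mneg x.1, S.mneg_mem _ x.2⟩
  mzero := ⟨mzero, S.mzero_mem⟩
  oplus_assoc _ _ _ := Subtype.ext (oplus_assoc _ _ _)
  oplus_comm _ _ := Subtype.ext (oplus_comm _ _)
  oplus_mzero _ := Subtype.ext (oplus_mzero _)
  mneg_mneg _ := Subtype.ext (mneg_mneg _)
  oplus_mneg_mzero _ := Subtype.ext (oplus_mneg_mzero _)
  mneg_oplus_mneg_oplus _ _ := Subtype.ext (mneg_oplus_mneg_oplus _ _)

/-- The standard MV-algebra on `[0,1]`: `x ⊕ y = min 1 (x + y)` and `¬ x = 1 - x`. -/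
noncomputable instance : MVAlgebra unitInterval where
  oplus x y := ⟨min 1 (x.1 + y.1), le_min zero_le_one (add_nonneg x.2.1 y.2.1), min_le_left _ _⟩
  mneg x := ⟨1 - x.1, sub_nonneg.2 x.2.2, sub_le_self _ x.2.1⟩
  mzero := 0
  oplus_assoc x y z := by
    have hx := x.2.1
    have hz := z.2.1
    apply Subtype.ext
    simp only []
    grind
  oplus_comm x y := by
    apply Subtype.ext
    simp only [add_comm]
  oplus_mzero x := by
    have hx := x.2.2
    apply Subtype.ext
    simp [hx]
  mneg_mneg x := by
    apply Subtype.ext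
    simp
  oplus_mneg_mzero x := by
    have hx := x.2.1
    apply Subtype.ext
    simp [hx]
  mneg_oplus_mneg_oplus x y := by
    have hx := x.2
    have hy := y.2
    apply Subtype.ext
    simp only []
    grind

/-- Functions into an MV-algebra, with the pointwise operations. -/
instance {X A : Type*} [MVAlgebra A] : MVAlgebra (X → A) where
  oplus f g := fun x => oplus (f x) (g x)
  mneg f := fun x => mneg (f x)
  mzero := fun _ => mzero
  oplus_assoc _ _ _ := funext fun _ => oplus_assoc _ _ _
  oplus_comm _ _ := funext fun _ => oplus_comm _ _
  oplus_mzero _ := funext fun _ => oplus_mzero _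
  mneg_mneg _ := funext fun _ => mneg_mneg _
  oplus_mneg_mzero _ := funext fun _ => oplus_mneg_mzero _
  mneg_oplus_mneg_oplus _ _ := funext fun _ => mneg_oplus_mneg_oplus _ _

end MVAlgebra

namespace McNaughton

open MVAlgebra

/-- The unit cube `[0,1]^n`, with the product topology. -/
abbrev Cube (n : ℕ) : Type := Fin n → unitInterval

/-- McNaughton functions, i.e. `[0,1]`-valued `ℤ`-maps on the cube: continuous functions that
agree at each point with one of finitely many affine functions with integer coefficients
(`p.1` is the linear part, `p.2` the constant term of the piece `p`). -/
def IsMcNaughton {n : ℕ} (f : Cube n → unitInterval) : Prop :=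
  Continuous f ∧ ∃ S : Finset ((Fin n → ℤ) × ℤ), ∀ x : Cube n, ∃ p ∈ S,
    (f x : ℝ) = ∑ i, (p.1 i : ℝ) * (x i : ℝ) + (p.2 : ℝ)

theorem isMcNaughton_mzero {n : ℕ} : IsMcNaughton (mzero : Cube n → unitInterval) := by
  refine ⟨(continuous_const : Continuous fun _ : Cube n => (0 : unitInterval)), {(0, 0)}, ?_⟩
  intro x
  exact ⟨(0, 0), by simp, by simp [mzero]⟩

theorem IsMcNaughton.mneg {n : ℕ} {f : Cube n → unitInterval} (hf : IsMcNaughton f) :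
    IsMcNaughton (mneg f) := by
  classical
  obtain ⟨hc, S, hS⟩ := hf
  refine ⟨Continuous.subtype_mk (by fun_prop) _,
    S.image (fun p => (fun i => - p.1 i, 1 - p.2)), ?_⟩
  intro x
  obtain ⟨p, hp, h⟩ := hS x
  refine ⟨_, Finset.mem_image_of_mem _ hp, ?_⟩
  change 1 - (f x : ℝ) = _
  rw [h]
  push_cast
  simp only [neg_mul, Finset.sum_neg_distrib]
  ring

theorem IsMcNaughton.oplus {n : ℕ} {f g : Cube n → unitInterval} (hf : IsMcNaughton f)
    (hg : IsMcNaughton g) : IsMcNaughton (oplus f g) := by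
  classical
  obtain ⟨hc, S, hS⟩ := hf
  obtain ⟨hd, T, hT⟩ := hg
  refine ⟨Continuous.subtype_mk (by fun_prop) _,
    insert (0, 1) ((S ×ˢ T).image (fun q => (fun i => q.1.1 i + q.2.1 i, q.1.2 + q.2.2))), ?_⟩
  intro x
  obtain ⟨p, hp, h⟩ := hS x
  obtain ⟨q, hq, h'⟩ := hT x
  rcases le_total (1 : ℝ) ((f x : ℝ) + g x) with h1 | h1
  · refine ⟨(0, 1), Finset.mem_insert_self _ _, ?_⟩
    change min 1 ((f x : ℝ) + g x) = _
    simp [h1]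
  · refine ⟨_, Finset.mem_insert_of_mem
      (Finset.mem_image_of_mem _ (Finset.mem_product.2 ⟨hp, hq⟩ : (p, q) ∈ S ×ˢ T)), ?_⟩
    change min 1 ((f x : ℝ) + g x) = _
    rw [min_eq_right h1, h, h']
    push_cast
    simp only [add_mul, Finset.sum_add_distrib]
    ring

/-- The subalgebra of McNaughton functions in the MV-algebra of all functions on the cube. -/
def subalg (n : ℕ) : Subalg (Cube n → unitInterval) where
  carrier := {f | IsMcNaughton f}
  mzero_mem := isMcNaughton_mzero
  mneg_mem _ hf := IsMcNaughton.mneg hf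
  oplus_mem _ hf _ hg := IsMcNaughton.oplus hf hg

/-- The MV-algebra `M([0,1]^n)` of McNaughton functions. -/
abbrev McN (n : ℕ) : Type := (subalg n).carrier

/-- The MV-algebra `M(P)` of restrictions to `P` of the McNaughton functions on the cube. -/
def restrictSubalg {n : ℕ} (P : Set (Cube n)) : Subalg (P → unitInterval) where
  carrier := {g | ∃ f : McN n, g = P.domRestrict f.1}
  mzero_mem := ⟨mzero, rfl⟩
  mneg_mem := by
    rintro _ ⟨f, rfl⟩
    exact ⟨mneg f, rfl⟩
  oplus_mem := by
    rintro _ ⟨f, rfl⟩ _ ⟨g, rfl⟩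
    exact ⟨oplus f g, rfl⟩

/-- The MV-algebra `M(P)`, as a type. -/
abbrev McNOn {n : ℕ} (P : Set (Cube n)) : Type := (restrictSubalg P).carrier

/-- The `i`-th coordinate function, as an element of `M([0,1]^n)`. -/
noncomputable def proj {n : ℕ} (i : Fin n) : McN n :=
  ⟨fun x => x i, continuous_apply i, {(Pi.single i 1, 0)}, fun x =>
    ⟨_, Finset.mem_singleton_self _, by simp [Pi.single_apply]⟩⟩

/-- The retractions of `M([0,1]^n)` onto `A`: the idempotent endomorphisms with range `A`. -/
def retractionsOnto {n : ℕ} (A : Subalg (McN n)) : Set (Hom (McN n) (McN n)) :=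
  {ε | (∀ f, ε (ε f) = ε f) ∧ Set.range ε = A.carrier}

/-- `A` is a retract of `M([0,1]^n)`. -/
def IsRetract {n : ℕ} (A : Subalg (McN n)) : Prop :=
  ∃ ε, ε ∈ retractionsOnto A

/-- The self-map `(ε(π₁), …, ε(πₙ))` of the cube attached to an endomorphism `ε`. -/
noncomputable def dualMap {n : ℕ} (ε : Hom (McN n) (McN n)) : Cube n → Cube n :=
  fun x i => (ε (proj i)).1 x

/-- `ℤ`-retractions of the cube: idempotent self-maps all of whose components are
McNaughton functions. -/
def IsZRetraction {n : ℕ} (σ : Cube n → Cube n) : Prop :=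
  (∀ i, IsMcNaughton (fun x => σ x i)) ∧ ∀ x, σ (σ x) = σ x

/-- `ℤ`-retracts of the cube: ranges of `ℤ`-retractions. -/
def IsZRetract {n : ℕ} (Q : Set (Cube n)) : Prop :=
  ∃ σ : Cube n → Cube n, IsZRetraction σ ∧ Set.range σ = Q

/-- Kuratowski closed domains: sets equal to the closure of their interior. -/
def IsClosedDomain {X : Type*} [TopologicalSpace X] (D : Set X) : Prop :=
  closure (interior D) = D

/-- "The maximal spectral space of `B` is a closed domain in `[0,1]^n`": up to isomorphism, `B` is
`M(Q)` for a `ℤ`-retract `Q` of the cube that is a closed domain in the cube. (For a `ℤ`-retract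
`Q` with `B ≅ M(Q)`, the maximal spectral space of `B` is homeomorphic to `Q`, and `Q` is unique up
to `ℤ`-homeomorphism.) -/
def MaxSpecIsClosedDomain (n : ℕ) (B : Type*) [MVAlgebra B] : Prop :=
  ∃ Q : Set (Cube n), IsZRetract Q ∧ Isomorphic B (McNOn Q) ∧ IsClosedDomain Q

/-- The set of connected components of the subspace `U`, as subsets of the ambient space. -/
def components {X : Type*} [TopologicalSpace X] (U : Set X) : Set (Set X) :=
  {C | ∃ x ∈ U, C = connectedComponentIn U x}

/-- The `n`-dimensional Lebesgue measure of a subset of the cube. -/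
noncomputable def lebesgue {n : ℕ} (O : Set (Cube n)) : ℝ :=
  (volume : Measure (Fin n → ℝ)).real ((fun (x : Cube n) (i : Fin n) => (x i : ℝ)) '' O)

end McNaughton

/-!
The argument passes from retractions of the algebra to piecewise affine retractions of the cube.

Every homomorphism from `M([0,1]^n)` to `[0,1]` is the evaluation at a point (`hom_eq_eval`): its
kernel has a common zero `y` by compactness, and repeated doubling shows that the homomorphism can
only be the evaluation at `y`. Hence an endomorphism `ε` is composition with its dual map, and two
retractions `ε`, `δ` onto the same subalgebra have dual maps `σ`, `τ` with `σ ∘ τ = σ` and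
`τ ∘ σ = τ`. So `τ` is determined by its restriction to the range `S` of `σ`, and there it is a
section of `σ`. In the same way the isomorphism of `A` with `M(Q)` is dual to a piecewise affine
bijection of `Q` with `S`, so that the interior of `S` is dense in `S` because that of `Q` is
dense in `Q`.

The geometric core replaces invariance of domain by elementary linear algebra. An injective
piecewise affine map is open at all points that lie on at most one of the hyperplanes ("walls")
where two of its pieces agree (`PiecewiseAffine.image_mem_nhds`). The remaining points have
codimension two, so that deleting them does not disconnect a connected open set
(`isPreconnected_inter_nearlyRegularPoints`). It follows that two sections of `σ` over a component
`O` of the interior of `S` coincide on `O` as soon as they agree at one such point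
(`HasPieces.eqOn_of_leftInvOn`). Consequently the images of the components under the dual maps of
all retractions onto `A` are, up to null sets, pairwise equal or disjoint.

These images are not smaller than the components, because an injective affine map with integer
coefficients has a nonzero integer determinant. So at most `⌊1 / λ⌋` different images fit into the
cube. A retraction is determined by the set of the `k` images of the components under its dual
map, which leaves at most `⌊1 / λ⌋` choose `k` retractions (`card_retractions_le`). The components
are finite in number since each contains a full cell of a finite arrangement of hyperplanes
(`HasPieces.finite_components`).
-/

/-! ### Walls of finite sets of affine functions -/

namespace PiecewiseAffine

variable {E : Type*} [NormedAddCommGroup E] [NormedSpace ℝ E]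

theorem affineMap_apply_add (f : E →ᵃ[ℝ] ℝ) (x v : E) : f (x + v) = f x + f.linear v := by
  rw [add_comm x v, add_comm (f x)]
  exact f.map_vadd x v

theorem affineMap_eq_add {F : Type*} [NormedAddCommGroup F] [NormedSpace ℝ F] (f : E →ᵃ[ℝ] F)
    (x y : E) : f y = f x + f.linear (y - x) := by
  have := f.linearMap_vsub y x
  simp only [vsub_eq_sub] at this
  rw [this]; abel

/-- The walls of a finite set of affine functions: the differences of two distinct members. A
function that is piecewise given by members of `P` can change its piece only where a wall
vanishes. -/
noncomputable def walls (P : Finset (E →ᵃ[ℝ] ℝ)) : Finset (E →ᵃ[ℝ] ℝ) := by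
  classical exact P.offDiag.image fun q => q.1 - q.2

theorem mem_walls {P : Finset (E →ᵃ[ℝ] ℝ)} {h : E →ᵃ[ℝ] ℝ} :
    h ∈ walls P ↔ ∃ p ∈ P, ∃ q ∈ P, p ≠ q ∧ p - q = h := by
  classical
  simp only [walls, Finset.mem_image, Finset.mem_offDiag, Prod.exists]
  grind

theorem ne_zero_of_mem_walls {P : Finset (E →ᵃ[ℝ] ℝ)} {h : E →ᵃ[ℝ] ℝ} (hh : h ∈ walls P) :
    h ≠ 0 := by
  obtain ⟨p, -, q, -, hne, rfl⟩ := mem_walls.1 hh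
  exact sub_ne_zero.2 hne

/-- `x` lies on no wall of `H`. -/
def OffWalls (H : Finset (E →ᵃ[ℝ] ℝ)) (x : E) : Prop :=
  ∀ h ∈ H, h x ≠ 0

/-- `x` lies on at most one of the walls of `H`, walls with the same zero set being identified. -/
def OnAtMostOneWall (H : Finset (E →ᵃ[ℝ] ℝ)) (x : E) : Prop :=
  ∀ h ∈ H, ∀ k ∈ H, h x = 0 → k x = 0 → ∀ y, h y = 0 ↔ k y = 0

theorem OffWalls.onAtMostOneWall {H : Finset (E →ᵃ[ℝ] ℝ)} {x : E} (hx : OffWalls H x) :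
    OnAtMostOneWall H x :=
  fun h hh _ _ h0 => absurd h0 (hx h hh)

/-- On a preconnected set that meets no wall, a continuous function that is piecewise given by
finitely many functions is given by a single one of them. -/
theorem exists_eqOn_piece {X : Type*} [TopologicalSpace X] {ι : Type*} (P : Finset ι)
    (φ : ι → X → ℝ) (hφ : ∀ p ∈ P, Continuous (φ p)) {C : Set X} (hC : IsPreconnected C)
    {f : X → ℝ} (hf : ContinuousOn f C) (hP : ∀ x ∈ C, ∃ p ∈ P, f x = φ p x)
    (hne : ∀ x ∈ C, ∀ p ∈ P, ∀ q ∈ P, p ≠ q → φ p x ≠ φ q x)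
    {x₀ : X} (hx₀ : x₀ ∈ C) : ∃ p ∈ P, f x₀ = φ p x₀ ∧ ∀ x ∈ C, f x = φ p x := by
  obtain ⟨p, hp, hpx⟩ := hP x₀ hx₀
  refine ⟨p, hp, hpx, ?_⟩
  have := isPreconnected_iff_preconnectedSpace.1 hC
  have hcl : ∀ q ∈ P, IsClosed {x : C | f x = φ q x} := fun q hq =>
    isClosed_eq hf.domRestrict ((hφ q hq).comp continuous_subtype_val)
  have hop : IsOpen {x : C | f x = φ p x} := by
    have hco : {x : C | f x = φ p x}ᶜ = ⋃ q ∈ {q | q ∈ P ∧ q ≠ p}, {x : C | f x = φ q x} := by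
      ext x
      simp only [Set.mem_compl_iff, Set.mem_ofPred_eq, Set.mem_iUnion, exists_prop]
      constructor
      · intro h
        obtain ⟨q, hq, hqx⟩ := hP x x.2
        exact ⟨q, ⟨hq, by rintro rfl; exact h hqx⟩, hqx⟩
      · rintro ⟨q, ⟨hq, hqp⟩, hqx⟩ h
        exact hne x x.2 q hq p hp hqp (hqx.symm.trans h)
    rw [← isClosed_compl_iff, hco]
    exact (P.finite_toSet.subset fun q hq => hq.1).isClosed_biUnion fun q hq => hcl q hq.1
  have huniv := IsClopen.eq_univ ⟨hcl p hp, hop⟩ ⟨⟨x₀, hx₀⟩, hpx⟩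
  intro x hx
  have : (⟨x, hx⟩ : C) ∈ {x : C | f x = φ p x} := huniv ▸ Set.mem_univ _
  exact this

section FiniteDimensional

variable [FiniteDimensional ℝ E]

theorem isOpen_offWalls (H : Finset (E →ᵃ[ℝ] ℝ)) : IsOpen {x | OffWalls H x} := by
  have : {x | OffWalls H x} = ⋂ h ∈ H, {x | h x ≠ 0} := by
    ext; simp [OffWalls]
  rw [this]
  exact isOpen_biInter_finset fun h _ =>
    isOpen_ne_fun h.continuous_of_finiteDimensional continuous_const

theorem addHaar_zeroSet [MeasurableSpace E] [BorelSpace E] (μ : Measure E) [μ.IsAddHaarMeasure]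
    {h : E →ᵃ[ℝ] ℝ} (hh : h ≠ 0) : μ {x | h x = 0} = 0 := by
  have hs : ((AffineSubspace.mk' (0 : ℝ) ⊥).comap h : Set E) = {x | h x = 0} := by
    ext x
    simp [AffineSubspace.mem_mk']
  rw [← hs]
  apply Measure.addHaar_affineSubspace
  intro htop
  apply hh
  ext x
  have : x ∈ ((AffineSubspace.mk' (0 : ℝ) ⊥).comap h : Set E) := by rw [htop]; trivial
  rw [hs] at this
  exact this

theorem addHaar_not_offWalls [MeasurableSpace E] [BorelSpace E] (μ : Measure E)
    [μ.IsAddHaarMeasure] {H : Finset (E →ᵃ[ℝ] ℝ)} (hH : ∀ h ∈ H, h ≠ 0) :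
    μ {x | ¬ OffWalls H x} = 0 := by
  have : {x | ¬ OffWalls H x} = ⋃ h ∈ H, {x | h x = 0} := by
    ext; simp [OffWalls]
  rw [this]
  exact (measure_biUnion_null_iff H.countable_toSet).2 fun h hh => addHaar_zeroSet μ (hH h hh)

theorem exists_offWalls {H : Finset (E →ᵃ[ℝ] ℝ)} (hH : ∀ h ∈ H, h ≠ 0) {V : Set E}
    (hV : IsOpen V) (hne : V.Nonempty) : ∃ c ∈ V, OffWalls H c := by
  borelize E
  by_contra! hcon
  refine (hV.measure_pos Measure.addHaar hne).ne' ?_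
  exact measure_mono_null (fun x hx => hcon x hx) (addHaar_not_offWalls _ hH)

/-- The points of a convex open set that lie on at most one wall form a preconnected set: two of
them can be joined through a generic third point by two segments that miss the pairwise
intersections of the walls, since the points `c` for which the segment from `a` to `c` meets the
intersection of the walls `h` and `k` satisfy the affine equation `h a * k c = k a * h c`. -/
theorem isPreconnected_onAtMostOneWall {H : Finset (E →ᵃ[ℝ] ℝ)} (hH : ∀ h ∈ H, h ≠ 0) {V : Set E}
    (hV : IsOpen V) (hc : Convex ℝ V) : IsPreconnected {x ∈ V | OnAtMostOneWall H x} := by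
  classical
  let K : E → Finset (E →ᵃ[ℝ] ℝ) := fun a =>
    ((H ×ˢ H).image fun q => q.1 a • q.2 - q.2 a • q.1).filter (· ≠ 0)
  have key : ∀ a c, OnAtMostOneWall H a → OffWalls (K a) c → ∀ y ∈ segment ℝ a c,
      OnAtMostOneWall H y := by
    intro a c ha hc y hy h hh k hk hy0 ky0
    obtain ⟨t, -, rfl⟩ := (segment_eq_image_lineMap ℝ a c ▸ hy : y ∈ _ '' _)
    rw [AffineMap.apply_lineMap, AffineMap.lineMap_apply, vsub_eq_sub, vadd_eq_add,
      smul_eq_mul] at hy0 ky0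
    by_cases h0 : h a • k - k a • h = 0
    · have hz : ∀ z, h a * k z = k a * h z := by
        intro z
        have := congrArg (fun f : E →ᵃ[ℝ] ℝ => f z) h0
        simpa [sub_eq_zero] using this
      by_cases h1 : h a = 0
      · by_cases h2 : k a = 0
        · exact ha h hh k hk h1 h2
        · exfalso
          apply hH h hh
          ext z
          have := hz z
          rw [h1, zero_mul] at this
          simpa [h2] using this.symm
      · by_cases h2 : k a = 0
        · exfalso
          apply hH k hk
          ext z
          have := hz z
          rw [h2, zero_mul] at this
          simpa [h1] using this
        · intro z
          have := hz z
          constructor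
          · intro hz0
            rw [hz0, mul_zero] at this
            simpa [h1] using this
          · intro hz0
            rw [hz0, mul_zero] at this
            simpa [h2] using this.symm
    · have hmem : h a • k - k a • h ∈ K a := by
        simp only [K, Finset.mem_filter, Finset.mem_image, Finset.mem_product]
        exact ⟨⟨(h, k), ⟨hh, hk⟩, rfl⟩, h0⟩
      have hne := hc _ hmem
      have hval : (h a • k - k a • h) c = h a * k c - k a * h c := by simp
      rw [hval] at hne
      rcases eq_or_ne t 0 with rfl | ht
      · simp only [zero_mul, zero_add] at hy0 ky0
        exact ha h hh k hk hy0 ky0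
      · refine absurd ?_ hne
        apply mul_left_cancel₀ ht
        linear_combination h a * ky0 - k a * hy0
  apply isPreconnected_of_forall_pair
  rintro a ⟨haV, ha⟩ b ⟨hbV, hb⟩
  obtain ⟨c, hcV, hcc⟩ := exists_offWalls (H := H ∪ (K a ∪ K b)) (by
    intro h hh
    simp only [Finset.mem_union] at hh
    rcases hh with hh | hh | hh
    · exact hH h hh
    · exact (Finset.mem_filter.1 hh).2
    · exact (Finset.mem_filter.1 hh).2) hV ⟨a, haV⟩
  refine ⟨segment ℝ a c ∪ segment ℝ b c, ?_, Or.inl (left_mem_segment ℝ _ _),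
    Or.inr (left_mem_segment ℝ _ _), ?_⟩
  · rintro y (hy | hy)
    · exact ⟨hc.segment_subset haV hcV hy, key a c ha (fun h hh => hcc h (by simp [hh])) y hy⟩
    · exact ⟨hc.segment_subset hbV hcV hy, key b c hb (fun h hh => hcc h (by simp [hh])) y hy⟩
  · exact IsPreconnected.union c (right_mem_segment ℝ _ _) (right_mem_segment ℝ _ _)
      (convex_segment a c).isPreconnected (convex_segment b c).isPreconnected

end FiniteDimensional

/-- A dense subset `G` of a preconnected set `O` is preconnected if every point of `O` has an open
neighbourhood whose trace on `G` is preconnected: deleting a set that does not separate locally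
does not separate globally. -/
theorem isPreconnected_of_locally_dense {X : Type*} [TopologicalSpace X] {O G : Set X}
    (hO : IsPreconnected O) (hG : G ⊆ O) (hd : O ⊆ closure G)
    (hloc : ∀ x ∈ O, ∃ N, IsOpen N ∧ x ∈ N ∧ IsPreconnected (N ∩ G)) : IsPreconnected G := by
  intro u v hu hv huv hGu hGv
  by_contra hemp
  let U : Set X → Set X := fun w => ⋃₀ {N | IsOpen N ∧ N ∩ G ⊆ w}
  have hUo : ∀ w, IsOpen (U w) := fun w => isOpen_sUnion fun N hN => hN.1
  have hsub : O ⊆ U u ∪ U v := by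
    intro x hx
    obtain ⟨N, hN, hxN, hpre⟩ := hloc x hx
    by_cases h1 : (N ∩ G ∩ u).Nonempty
    · by_cases h2 : (N ∩ G ∩ v).Nonempty
      · obtain ⟨z, hz, hzuv⟩ := hpre u v hu hv (fun z hz => huv hz.2) h1 h2
        exact absurd ⟨z, hz.2, hzuv⟩ hemp
      · refine Or.inl ⟨N, ⟨hN, fun z hz => ?_⟩, hxN⟩
        exact (huv hz.2).resolve_right fun hzv => h2 ⟨z, hz, hzv⟩
    · refine Or.inr ⟨N, ⟨hN, fun z hz => ?_⟩, hxN⟩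
      exact (huv hz.2).resolve_left fun hzv => h1 ⟨z, hz, hzv⟩
  have hmeet : ∀ w, IsOpen w → (G ∩ w).Nonempty → (O ∩ U w).Nonempty := by
    rintro w hw ⟨z, hzG, hzw⟩
    exact ⟨z, hG hzG, w, ⟨hw, Set.inter_subset_left⟩, hzw⟩
  obtain ⟨x, hxO, ⟨N, ⟨hN, hNu⟩, hxN⟩, ⟨M, ⟨hM, hMv⟩, hxM⟩⟩ :=
    hO (U u) (U v) (hUo u) (hUo v) hsub (hmeet u hu hGu) (hmeet v hv hGv)
  obtain ⟨z, ⟨hzN, hzM⟩, hzG⟩ := mem_closure_iff.1 (hd hxO) (N ∩ M) (hN.inter hM) ⟨hxN, hxM⟩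
  exact hemp ⟨z, hzG, hNu ⟨hzN, hzG⟩, hMv ⟨hzM, hzG⟩⟩

end PiecewiseAffine

/-! ### Injective piecewise affine maps are open near single walls -/

namespace PiecewiseAffine

section Map

variable {n : ℕ}

theorem exists_eqOn_affineMap {P : Finset ((Fin n → ℝ) →ᵃ[ℝ] ℝ)} {V : Set (Fin n → ℝ)}
    {F : (Fin n → ℝ) → Fin n → ℝ} (hV : IsPreconnected V) (hne : V.Nonempty)
    (hF : ContinuousOn F V) (hP : ∀ x ∈ V, ∀ i, ∃ p ∈ P, F x i = p x)
    (hw : ∀ x ∈ V, OffWalls (walls P) x) :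
    ∃ p : Fin n → ((Fin n → ℝ) →ᵃ[ℝ] ℝ), (∀ i, p i ∈ P) ∧ Set.EqOn F (AffineMap.pi p) V := by
  obtain ⟨x₀, hx₀⟩ := hne
  have : ∀ i, ∃ p ∈ P, F x₀ i = p x₀ ∧ ∀ x ∈ V, F x i = p x := fun i =>
    exists_eqOn_piece (f := fun x => F x i) P (fun p x => p x)
      (fun p _ => p.continuous_of_finiteDimensional) hV
      (fun x hx => (continuous_apply i).continuousAt.comp_continuousWithinAt (hF x hx))
      (fun x hx => hP x hx i)
      (fun x hx p hp q hq hpq h => hw x hx _ (mem_walls.2 ⟨p, hp, q, hq, hpq, rfl⟩)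
        (by simp [h])) hx₀
  choose p hp _ hpV using this
  exact ⟨p, hp, fun x hx => funext fun i => hpV i x hx⟩

theorem linear_injective_of_injOn {E : Type*} [NormedAddCommGroup E] [NormedSpace ℝ E]
    {L : E →ᵃ[ℝ] E} {V : Set E} (hV : IsOpen V) (hne : V.Nonempty) (hL : Set.InjOn L V) :
    Function.Injective L.linear := by
  rw [injective_iff_map_eq_zero]
  intro v hv
  obtain ⟨x, hx⟩ := hne
  have hcont : Filter.Tendsto (fun t : ℝ => x + t • v) (𝓝[>] 0) (𝓝 x) := by
    have : Continuous fun t : ℝ => x + t • v := by fun_prop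
    simpa using (this.tendsto 0).mono_left nhdsWithin_le_nhds
  have hpos : ∀ᶠ t : ℝ in 𝓝[>] 0, 0 < t := self_mem_nhdsWithin
  obtain ⟨t, ht, htV⟩ :=
    (hpos.and (hcont (hV.mem_nhds hx))).exists
  have h := hL htV hx (by rw [affineMap_eq_add L x]; simp [hv])
  rw [add_eq_left] at h
  exact (smul_eq_zero.1 h).resolve_left (ne_of_gt ht)

theorem exists_continuous_inverse {E : Type*} [NormedAddCommGroup E] [NormedSpace ℝ E]
    [FiniteDimensional ℝ E] {L : E →ᵃ[ℝ] E} (hL : Function.Injective L.linear) :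
    ∃ G : E → E, Continuous G ∧ (∀ q, L (G q) = q) ∧ ∀ y, G (L y) = y := by
  have hb : Function.Bijective L :=
    L.linear_bijective_iff.1 ⟨hL, LinearMap.injective_iff_surjective.1 hL⟩
  let e := AffineEquiv.ofBijective hb
  exact ⟨e.symm, e.symm.toAffineMap.continuous_of_finiteDimensional, e.apply_symm_apply,
    e.symm_apply_apply⟩

/-- A continuous map that is affine on the open side `0 < ℓ` of a wall is given there by the same
affine map up to the wall. -/
theorem eqOn_closed_side {E : Type*} [NormedAddCommGroup E] [NormedSpace ℝ E]
    [FiniteDimensional ℝ E] {F : E → E} {L : E →ᵃ[ℝ] E} {ℓ : E →ᵃ[ℝ] ℝ} {B : Set E}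
    (hB : IsOpen B) (hF : ContinuousOn F B) {v : E} (hv : 0 < ℓ.linear v)
    (hL : ∀ y ∈ B, 0 < ℓ y → F y = L y) : ∀ y ∈ B, 0 ≤ ℓ y → F y = L y := by
  intro y hy hℓ
  have hcont : Filter.Tendsto (fun t : ℝ => y + t • v) (𝓝[>] 0) (𝓝 y) := by
    have : Continuous fun t : ℝ => y + t • v := by fun_prop
    simpa using (this.tendsto 0).mono_left nhdsWithin_le_nhds
  have h1 : Filter.Tendsto (fun t : ℝ => F (y + t • v)) (𝓝[>] 0) (𝓝 (F y)) :=
    (hF.continuousAt (hB.mem_nhds hy)).tendsto.comp hcont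
  have h2 : Filter.Tendsto (fun t : ℝ => L (y + t • v)) (𝓝[>] 0) (𝓝 (L y)) :=
    (L.continuous_of_finiteDimensional.tendsto y).comp hcont
  refine tendsto_nhds_unique h1 (h2.congr' ?_)
  filter_upwards [self_mem_nhdsWithin, hcont (hB.mem_nhds hy)] with t ht htB
  refine (hL _ htB ?_).symm
  rw [affineMap_apply_add, map_smul, smul_eq_mul]
  have : 0 < t * ℓ.linear v := mul_pos ht hv
  linarith

/-- An injective piecewise affine map is open at every point that lies on at most one wall. Off the
walls the map is affine near the point. On a single wall `ℓ = 0` it is given by two affine maps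
`L₁` and `L₂` that agree on the wall, so that `L₂ y = L₁ (y + ℓ y • u)` for a vector `u`;
injectivity forces `L₁` and `L₂` to map the two sides of the wall to different sides, that is
`0 < 1 + ℓ.linear u`, and then the two half-neighbourhoods together cover a neighbourhood of the
image. -/
theorem image_mem_nhds {P : Finset ((Fin n → ℝ) →ᵃ[ℝ] ℝ)} {V : Set (Fin n → ℝ)}
    {F : (Fin n → ℝ) → Fin n → ℝ} (hV : IsOpen V) (hF : ContinuousOn F V) (hinj : Set.InjOn F V)
    (hP : ∀ x ∈ V, ∀ i, ∃ p ∈ P, F x i = p x) {x : Fin n → ℝ} (hx : x ∈ V)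
    (hw : OnAtMostOneWall (walls P) x) : F '' V ∈ 𝓝 (F x) := by
  have hev : ∀ᶠ y in 𝓝 x, y ∈ V ∧ ∀ k ∈ walls P, k x ≠ 0 → k y ≠ 0 := by
    refine Filter.Eventually.and (hV.mem_nhds hx) ?_
    rw [Filter.eventually_all_finset]
    intro k _
    by_cases hk : k x = 0
    · simp [hk]
    · filter_upwards [k.continuous_of_finiteDimensional.continuousAt.eventually_ne hk] with y hy _
      exact hy
  obtain ⟨r, hr, hball⟩ := Metric.eventually_nhds_iff_ball.1 hev
  have hxB : x ∈ Metric.ball x r := Metric.mem_ball_self hr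
  have hBV : Metric.ball x r ⊆ V := fun y hy => (hball y hy).1
  have hFB := hF.mono hBV
  by_cases hall : OffWalls (walls P) x
  · obtain ⟨p, -, hpB⟩ := exists_eqOn_affineMap (convex_ball x r).isPreconnected ⟨x, hxB⟩ hFB
      (fun y hy => hP y (hBV hy)) (fun y hy k hk => (hball y hy).2 k hk (hall k hk))
    set L : (Fin n → ℝ) →ᵃ[ℝ] (Fin n → ℝ) := AffineMap.pi p
    have hLi := linear_injective_of_injOn Metric.isOpen_ball ⟨x, hxB⟩
      ((hinj.mono hBV).congr hpB)
    obtain ⟨G, hG, hLG, hGL⟩ := exists_continuous_inverse hLi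
    have hGx : G (F x) = x := by rw [hpB hxB, hGL]
    have hGB : ∀ᶠ q in 𝓝 (F x), G q ∈ Metric.ball x r :=
      hG.continuousAt.eventually_mem (by rw [hGx]; exact Metric.ball_mem_nhds x hr)
    filter_upwards [hGB] with q hq
    exact ⟨G q, hBV hq, by rw [hpB hq, hLG]⟩
  · obtain ⟨ℓ, hℓ, hℓx⟩ : ∃ ℓ ∈ walls P, ℓ x = 0 := by simpa [OffWalls] using hall
    have hoff : ∀ y ∈ Metric.ball x r, ℓ y ≠ 0 → OffWalls (walls P) y := by
      intro y hy hℓy k hk hky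
      by_cases hkx : k x = 0
      · exact hℓy ((hw k hk ℓ hℓ hkx hℓx y).1 hky)
      · exact (hball y hy).2 k hk hkx hky
    obtain ⟨v, hv⟩ : ∃ v, ℓ.linear v = 1 := by
      obtain ⟨z, hz⟩ : ∃ z, ℓ z ≠ 0 := by
        by_contra! hcon
        exact ne_zero_of_mem_walls hℓ (by ext z; exact hcon z)
      have h1 := affineMap_eq_add ℓ x z
      rw [hℓx, zero_add] at h1
      refine ⟨(ℓ z)⁻¹ • (z - x), ?_⟩
      rw [map_smul, ← h1, smul_eq_mul, inv_mul_cancel₀ hz]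
    have hline : ∀ w : Fin n → ℝ, Filter.Tendsto (fun t : ℝ => x + t • w) (𝓝[>] 0) (𝓝 x) := by
      intro w
      have : Continuous fun t : ℝ => x + t • w := by fun_prop
      simpa using (this.tendsto 0).mono_left nhdsWithin_le_nhds
    have hsmall : ∀ w : Fin n → ℝ, ∀ᶠ t : ℝ in 𝓝[>] 0, x + t • w ∈ Metric.ball x r :=
      fun w => hline w (Metric.ball_mem_nhds x hr)
    have hpos : ∀ᶠ t : ℝ in 𝓝[>] 0, 0 < t := self_mem_nhdsWithin
    -- the affine maps on the two sides of the wall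
    have hside : ∀ m : (Fin n → ℝ) →ᵃ[ℝ] ℝ, (∀ y, m y ≠ 0 → ℓ y ≠ 0) → m x = 0 →
        (∃ w, 0 < m.linear w) → ∃ L : (Fin n → ℝ) →ᵃ[ℝ] (Fin n → ℝ),
          Function.Injective L.linear ∧ ∀ y ∈ Metric.ball x r, 0 ≤ m y → F y = L y := by
      rintro m hm hmx ⟨w, hmw⟩
      have hmc : Continuous m := m.continuous_of_finiteDimensional
      have hmconv : Convex ℝ {y | 0 < m y} := (convex_Ioi (0 : ℝ)).affine_preimage m
      have hop : IsOpen (Metric.ball x r ∩ {y | 0 < m y}) :=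
        Metric.isOpen_ball.inter (isOpen_lt continuous_const hmc)
      have hne : (Metric.ball x r ∩ {y | 0 < m y}).Nonempty := by
        obtain ⟨t, ht, ht0⟩ := ((hsmall w).and hpos).exists
        refine ⟨x + t • w, ht, ?_⟩
        change 0 < m (x + t • w)
        rw [affineMap_apply_add, hmx, map_smul, smul_eq_mul, zero_add]
        exact mul_pos ht0 hmw
      have hsub : Metric.ball x r ∩ {y | 0 < m y} ⊆ Metric.ball x r := Set.inter_subset_left
      obtain ⟨p, -, hp⟩ := exists_eqOn_affineMap ((convex_ball x r).inter hmconv).isPreconnected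
        hne (hFB.mono hsub) (fun y hy => hP y (hBV hy.1))
        (fun y hy => hoff y hy.1 (hm y (ne_of_gt hy.2)))
      exact ⟨AffineMap.pi p, linear_injective_of_injOn hop hne
        ((hinj.mono (hsub.trans hBV)).congr hp),
        eqOn_closed_side Metric.isOpen_ball hFB hmw fun y hy h0 => hp ⟨hy, h0⟩⟩
    obtain ⟨L₁, hL₁i, hL₁⟩ := hside ℓ (fun _ h => h) hℓx ⟨v, by rw [hv]; exact one_pos⟩
    obtain ⟨L₂, hL₂i, hL₂'⟩ := hside (-ℓ) (fun y hy => by simpa using hy) (by simp [hℓx])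
      ⟨-v, by simp [hv]⟩
    have hL₂ : ∀ y ∈ Metric.ball x r, ℓ y ≤ 0 → F y = L₂ y := fun y hy h0 =>
      hL₂' y hy (by simpa using h0)
    obtain ⟨u, hu⟩ := LinearMap.injective_iff_surjective.1 hL₁i (L₂.linear v - L₁.linear v)
    have hxx : L₂ x = L₁ x := by rw [← hL₁ x hxB hℓx.ge, ← hL₂ x hxB hℓx.le]
    have hker : ∀ z, ℓ.linear z = 0 → L₂.linear z = L₁.linear z := by
      intro z hz
      obtain ⟨t, ht, ht0⟩ := ((hsmall z).and hpos).exists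
      have hℓt : ℓ (x + t • z) = 0 := by rw [affineMap_apply_add, hℓx, map_smul, hz]; simp
      have h := (hL₂ _ ht hℓt.le).symm.trans (hL₁ _ ht hℓt.ge)
      rw [affineMap_eq_add L₂ x, affineMap_eq_add L₁ x, hxx] at h
      simp only [add_sub_cancel_left, map_smul, add_right_inj] at h
      exact smul_right_injective _ ht0.ne' h
    have hrel : ∀ y, L₂ y = L₁ (y + ℓ y • u) := by
      intro y
      have h1 : ℓ.linear (y - x - ℓ y • v) = 0 := by
        have := affineMap_eq_add ℓ x y
        rw [hℓx, zero_add] at this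
        rw [map_sub, ← this, map_smul, hv]; simp
      have h2 := hker _ h1
      rw [map_sub L₂.linear, map_sub L₁.linear, map_smul, map_smul, sub_eq_iff_eq_add] at h2
      rw [affineMap_eq_add L₂ x, affineMap_eq_add L₁ x (y + _), hxx, add_sub_right_comm,
        map_add L₁.linear, map_smul, hu, smul_sub, h2]
      abel
    set m := ℓ.linear u with hm
    have hℓu : ∀ y (t : ℝ), ℓ (y + t • u) = ℓ y + t * m := by
      intro y t
      rw [affineMap_apply_add, map_smul, smul_eq_mul]
    have hm1 : 0 < 1 + m := by
      rcases lt_trichotomy (1 + m) 0 with hneg | h0 | h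
      · exfalso
        -- both sides would be mapped to the same side, against injectivity
        obtain ⟨t, ⟨ht1, ht2⟩, ht0⟩ :=
          (((hsmall (-v)).and (hsmall (-v - u))).and hpos).exists
        have e1 : ℓ (x + t • (-v)) = -t := by
          rw [affineMap_apply_add, hℓx, map_smul, map_neg, hv]; simp
        have e2 : ℓ (x + t • (-v - u)) = -t * (1 + m) := by
          rw [affineMap_apply_add, hℓx, map_smul, map_sub, map_neg, hv, ← hm, smul_eq_mul]; ring
        have e3 : x + t • (-v) + (-t) • u = x + t • (-v - u) := by module
        have heq : F (x + t • (-v)) = F (x + t • (-v - u)) := by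
          rw [hL₂ _ ht1 (by rw [e1]; linarith), hL₁ _ ht2 (by rw [e2]; nlinarith), hrel, e1, e3]
        have h := hinj (hBV ht1) (hBV ht2) heq
        have h' := congrArg ℓ h
        rw [e1, e2] at h'
        nlinarith
      · exfalso
        have hu0 : u = 0 := by
          have hz : L₂ (x + (1 : ℝ) • u) = L₂ x := by
            rw [hrel, hrel x, hℓu, hℓx]
            congr 1
            have : m = -1 := by linarith
            rw [this]; module
          rw [affineMap_eq_add L₂ x] at hz
          simp only [one_smul, add_sub_cancel_left, add_eq_left] at hz
          exact hL₂i (hz.trans (map_zero _).symm)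
        rw [hm, hu0, map_zero] at h0
        norm_num at h0
      · exact h
    obtain ⟨G, hG, hLG, hGL⟩ := exists_continuous_inverse hL₁i
    have hGx : G (F x) = x := by rw [hL₁ x hxB hℓx.ge, hGL]
    let G' : (Fin n → ℝ) → Fin n → ℝ := fun q => G q + (-(ℓ (G q) / (1 + m))) • u
    have hG' : Continuous G' := by
      have : Continuous fun q => ℓ (G q) := ℓ.continuous_of_finiteDimensional.comp hG
      exact hG.add ((this.div_const _).neg.smul continuous_const)
    have hG'x : G' (F x) = x := by simp [G', hGx, hℓx]
    have hGB : ∀ᶠ q in 𝓝 (F x), G q ∈ Metric.ball x r :=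
      hG.continuousAt.eventually_mem (by rw [hGx]; exact Metric.ball_mem_nhds x hr)
    have hGB' : ∀ᶠ q in 𝓝 (F x), G' q ∈ Metric.ball x r :=
      hG'.continuousAt.eventually_mem (by rw [hG'x]; exact Metric.ball_mem_nhds x hr)
    filter_upwards [hGB, hGB'] with q hq hq'
    rcases le_total 0 (ℓ (G q)) with h0 | h0
    · exact ⟨G q, hBV hq, by rw [hL₁ _ hq h0, hLG]⟩
    · have e : ℓ (G' q) = ℓ (G q) / (1 + m) := by
        rw [hℓu]; field_simp; ring
      refine ⟨G' q, hBV hq', ?_⟩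
      rw [hL₂ _ hq' (by rw [e]; exact div_nonpos_of_nonpos_of_nonneg h0 hm1.le), hrel, e]
      have : G' q + (ℓ (G q) / (1 + m)) • u = G q := by
        simp only [G']; module
      rw [this, hLG]

end Map

end PiecewiseAffine

/-! ### Integer coefficients and volume -/

namespace PiecewiseAffine

variable {n : ℕ}

/-- The affine function with integer coefficients encoded by `p`, in the convention of
`McNaughton.IsMcNaughton`: `p.1` is the linear part and `p.2` the constant term. -/
noncomputable def intAffine (p : (Fin n → ℤ) × ℤ) : (Fin n → ℝ) →ᵃ[ℝ] ℝ :=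
  (∑ i, (p.1 i : ℝ) • (LinearMap.proj i : (Fin n → ℝ) →ₗ[ℝ] ℝ)).toAffineMap +
    AffineMap.const ℝ _ (p.2 : ℝ)

theorem intAffine_apply (p : (Fin n → ℤ) × ℤ) (x : Fin n → ℝ) :
    intAffine p x = ∑ i, (p.1 i : ℝ) * x i + p.2 := by
  simp [intAffine]

theorem intAffine_linear_apply (p : (Fin n → ℤ) × ℤ) (x : Fin n → ℝ) :
    (intAffine p).linear x = ∑ i, (p.1 i : ℝ) * x i := by
  simp [intAffine]

theorem one_le_abs_det_of_injective {p : Fin n → (Fin n → ℝ) →ᵃ[ℝ] ℝ}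
    (hp : ∀ i, p i ∈ Set.range intAffine) (hinj : Function.Injective (AffineMap.pi p).linear) :
    1 ≤ |LinearMap.det (AffineMap.pi p).linear| := by
  choose q hq using hp
  obtain rfl : (fun i => intAffine (q i)) = p := funext hq
  let M : Matrix (Fin n) (Fin n) ℤ := Matrix.of fun i j => (q i).1 j
  have hM : (AffineMap.pi fun i => intAffine (q i)).linear =
      Matrix.toLin' (M.map fun z => (z : ℝ)) := by
    refine LinearMap.ext fun x => funext fun i => ?_
    change (intAffine (q i)).linear x = _
    rw [intAffine_linear_apply]
    simp [M, Matrix.mulVec, dotProduct]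
  have hdet : LinearMap.det (AffineMap.pi fun i => intAffine (q i)).linear = (M.det : ℝ) := by
    rw [hM, LinearMap.det_toLin', Int.cast_det]
  have h0 : LinearMap.det (AffineMap.pi fun i => intAffine (q i)).linear ≠ 0 := by
    intro h
    exact (LinearMap.bot_lt_ker_of_det_eq_zero h).ne' (LinearMap.ker_eq_bot.2 hinj)
  rw [hdet] at h0 ⊢
  exact_mod_cast Int.one_le_abs (by exact_mod_cast h0)

/-- An injective piecewise affine map with integer coefficients does not decrease volume, since a
nonzero integer determinant has absolute value at least `1`. -/
theorem volume_le_volume_image {P : Finset ((Fin n → ℝ) →ᵃ[ℝ] ℝ)}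
    (hint : ∀ p ∈ P, p ∈ Set.range intAffine) {V : Set (Fin n → ℝ)}
    {F : (Fin n → ℝ) → Fin n → ℝ} (hV : IsOpen V) (hF : ContinuousOn F V) (hinj : Set.InjOn F V)
    (hP : ∀ x ∈ V, ∀ i, ∃ p ∈ P, F x i = p x) (hw : ∀ x ∈ V, OffWalls (walls P) x) :
    volume V ≤ volume (F '' V) := by
  have hder : ∀ x, ∃ f' : (Fin n → ℝ) →L[ℝ] (Fin n → ℝ),
      x ∈ V → HasFDerivWithinAt F f' V x ∧ 1 ≤ |f'.det| := by
    intro x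
    by_cases hx : x ∈ V
    · obtain ⟨r, hr, hball⟩ := Metric.isOpen_iff.1 hV x hx
      have hxB : x ∈ Metric.ball x r := Metric.mem_ball_self hr
      obtain ⟨p, hp, hpB⟩ := exists_eqOn_affineMap (convex_ball x r).isPreconnected ⟨x, hxB⟩
        (hF.mono hball) (fun y hy => hP y (hball hy)) (fun y hy => hw y (hball hy))
      have hLi := linear_injective_of_injOn Metric.isOpen_ball ⟨x, hxB⟩
        ((hinj.mono hball).congr hpB)
      refine ⟨(AffineMap.pi p).linear.toContinuousLinearMap, fun _ => ⟨?_, ?_⟩⟩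
      · have h1 : HasFDerivAt (AffineMap.pi p : (Fin n → ℝ) → Fin n → ℝ)
            (AffineMap.pi p).linear.toContinuousLinearMap x := by
          have h2 := ((AffineMap.pi p).linear.toContinuousLinearMap.hasFDerivAt
            (x := x)).add_const ((AffineMap.pi p) 0)
          rw [AffineMap.decomp (AffineMap.pi p)]
          exact h2
        exact (h1.congr_of_eventuallyEq
          (hpB.eventuallyEq_of_mem (Metric.ball_mem_nhds x hr))).hasFDerivWithinAt
      · exact one_le_abs_det_of_injective (fun i => hint _ (hp i)) hLi
    · exact ⟨0, fun h => absurd h hx⟩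
  choose f' hf' using hder
  rw [← lintegral_abs_det_fderiv_eq_addHaar_image volume hV.measurableSet
    (fun x hx => (hf' x hx).1) hinj, ← setLIntegral_one]
  refine setLIntegral_mono' hV.measurableSet fun x hx => ?_
  exact ENNReal.one_le_ofReal.2 (hf' x hx).2

end PiecewiseAffine

/-! ### Piecewise affine self-maps of the cube -/

namespace McNaughton

open PiecewiseAffine

variable {n : ℕ}

/-- The inclusion of the cube into `ℝⁿ`. -/
def toReal (x : Cube n) : Fin n → ℝ := fun i => x i

/-- The coordinatewise nearest-point retraction of `ℝⁿ` onto the cube. -/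
noncomputable def ofReal (y : Fin n → ℝ) : Cube n := fun i => Set.projIcc 0 1 zero_le_one (y i)

/-- The topological interior of the cube in `ℝⁿ`. -/
def openCube (n : ℕ) : Set (Fin n → ℝ) := Set.univ.pi fun _ => Set.Ioo 0 1

theorem continuous_toReal : Continuous (toReal : Cube n → Fin n → ℝ) :=
  continuous_pi fun i => continuous_subtype_val.comp (continuous_apply i)

theorem continuous_ofReal : Continuous (ofReal : (Fin n → ℝ) → Cube n) :=
  continuous_pi fun i => continuous_projIcc.comp (continuous_apply i)

theorem ofReal_toReal (x : Cube n) : ofReal (toReal x) = x :=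
  funext fun i => Set.projIcc_val _ (x i)

theorem toReal_ofReal {y : Fin n → ℝ} (hy : y ∈ Set.Icc (0 : Fin n → ℝ) 1) :
    toReal (ofReal y) = y :=
  funext fun i => congrArg Subtype.val
    (Set.projIcc_of_mem (zero_le_one' ℝ) (show y i ∈ Set.Icc 0 1 from ⟨hy.1 i, hy.2 i⟩))

theorem openCube_subset_Icc : openCube n ⊆ Set.Icc 0 1 :=
  fun _ hy => ⟨fun i => (hy i trivial).1.le, fun i => (hy i trivial).2.le⟩

theorem toReal_injective : Function.Injective (toReal : Cube n → Fin n → ℝ) :=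
  Function.LeftInverse.injective ofReal_toReal

theorem isInducing_toReal : IsInducing (toReal : Cube n → Fin n → ℝ) :=
  (IsEmbedding.of_leftInverse ofReal_toReal continuous_ofReal continuous_toReal).isInducing

theorem toReal_mem_Icc (x : Cube n) : toReal x ∈ Set.Icc (0 : Fin n → ℝ) 1 :=
  ⟨fun i => (x i).2.1, fun i => (x i).2.2⟩

theorem isOpen_openCube : IsOpen (openCube n) := isOpen_set_pi Set.finite_univ fun _ _ => isOpen_Ioo

theorem convex_openCube : Convex ℝ (openCube n) := convex_pi fun _ _ => convex_Ioo 0 1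

theorem toReal_mem_closure_openCube (x : Cube n) : toReal x ∈ closure (openCube n) := by
  rw [openCube, closure_pi_set]
  intro i _
  rw [closure_Ioo zero_ne_one]
  exact (x i).2

/-- `g` is a continuous self-map of the cube, each component of which agrees at each point with
one of the affine functions in `P`. -/
def HasPieces (P : Finset ((Fin n → ℝ) →ᵃ[ℝ] ℝ)) (g : Cube n → Cube n) : Prop :=
  Continuous g ∧ ∀ x i, ∃ p ∈ P, (g x i : ℝ) = p (toReal x)

theorem HasPieces.mono {P Q : Finset ((Fin n → ℝ) →ᵃ[ℝ] ℝ)} {g : Cube n → Cube n}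
    (hg : HasPieces P g) (h : P ⊆ Q) : HasPieces Q g :=
  ⟨hg.1, fun x i => let ⟨p, hp, e⟩ := hg.2 x i; ⟨p, h hp, e⟩⟩

theorem exists_hasPieces {g : Cube n → Cube n} (hg : ∀ i, IsMcNaughton fun x => g x i) :
    ∃ P : Finset ((Fin n → ℝ) →ᵃ[ℝ] ℝ), (∀ p ∈ P, p ∈ Set.range intAffine) ∧ HasPieces P g := by
  classical
  choose S hS using fun i => (hg i).2
  refine ⟨(Finset.univ.biUnion S).image intAffine, ?_, continuous_pi fun i => (hg i).1, ?_⟩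
  · intro p hp
    obtain ⟨q, -, rfl⟩ := Finset.mem_image.1 hp
    exact ⟨q, rfl⟩
  · intro x i
    obtain ⟨q, hq, e⟩ := hS i x
    exact ⟨intAffine q, Finset.mem_image_of_mem _ (Finset.mem_biUnion.2 ⟨i, Finset.mem_univ _, hq⟩),
      e.trans (intAffine_apply q _).symm⟩

/-- The interior points of the cube that lie on no wall of `P`. -/
def regularPoints (P : Finset ((Fin n → ℝ) →ᵃ[ℝ] ℝ)) : Set (Cube n) :=
  {x | toReal x ∈ openCube n ∧ OffWalls (walls P) (toReal x)}

/-- The interior points of the cube that lie on at most one wall of `P`. -/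
def nearlyRegularPoints (P : Finset ((Fin n → ℝ) →ᵃ[ℝ] ℝ)) : Set (Cube n) :=
  {x | toReal x ∈ openCube n ∧ OnAtMostOneWall (walls P) (toReal x)}

variable {P : Finset ((Fin n → ℝ) →ᵃ[ℝ] ℝ)}

theorem regularPoints_subset : regularPoints P ⊆ nearlyRegularPoints P :=
  fun _ hx => ⟨hx.1, hx.2.onAtMostOneWall⟩

theorem isOpen_regularPoints : IsOpen (regularPoints P) :=
  (isOpen_openCube.preimage continuous_toReal).inter
    ((isOpen_offWalls _).preimage continuous_toReal)

theorem dense_regularPoints : Dense (regularPoints P) := by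
  rw [dense_iff_inter_open]
  rintro U hU ⟨x, hx⟩
  have hne : (ofReal ⁻¹' U ∩ openCube n).Nonempty :=
    mem_closure_iff.1 (toReal_mem_closure_openCube x) _ (hU.preimage continuous_ofReal)
      (by rwa [Set.mem_preimage, ofReal_toReal])
  obtain ⟨c, ⟨hcU, hc⟩, hcw⟩ := exists_offWalls (fun h hh => ne_zero_of_mem_walls hh)
    ((hU.preimage continuous_ofReal).inter isOpen_openCube) hne
  have e := toReal_ofReal (openCube_subset_Icc hc)
  exact ⟨ofReal c, hcU, by rwa [e], by rwa [e]⟩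

theorem isPreconnected_preimage_toReal {C : Set (Fin n → ℝ)}
    (hC : IsPreconnected (C ∩ Set.Icc 0 1)) : IsPreconnected (toReal ⁻¹' C) := by
  rw [← isInducing_toReal.isPreconnected_image]
  convert hC
  ext y
  constructor
  · rintro ⟨x, hx, rfl⟩
    exact ⟨hx, toReal_mem_Icc x⟩
  · rintro ⟨hy, hy'⟩
    exact ⟨ofReal y, by rwa [Set.mem_preimage, toReal_ofReal hy'], toReal_ofReal hy'⟩

theorem exists_ball_preimage_subset {U : Set (Cube n)} (hU : IsOpen U) {x : Cube n} (hx : x ∈ U) :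
    ∃ r > 0, toReal ⁻¹' Metric.ball (toReal x) r ⊆ U := by
  have h := (hU.preimage continuous_ofReal).mem_nhds
    (show toReal x ∈ ofReal ⁻¹' U by rwa [Set.mem_preimage, ofReal_toReal])
  obtain ⟨r, hr, hb⟩ := Metric.mem_nhds_iff.1 h
  refine ⟨r, hr, fun y hy => ?_⟩
  have := hb hy
  rwa [Set.mem_preimage, ofReal_toReal] at this

instance : LocallyConnectedSpace (Cube n) := by
  rw [locallyConnectedSpace_iff_subsets_isOpen_isConnected]
  intro x U hU
  obtain ⟨V, hVU, hV, hxV⟩ := mem_nhds_iff.1 hU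
  obtain ⟨r, hr, hb⟩ := exists_ball_preimage_subset hV hxV
  refine ⟨_, hb.trans hVU, Metric.isOpen_ball.preimage continuous_toReal,
    Metric.mem_ball_self hr, ⟨x, Metric.mem_ball_self hr⟩, ?_⟩
  exact isPreconnected_preimage_toReal ((convex_ball _ _).inter (convex_Icc _ _)).isPreconnected

theorem isPreconnected_inter_nearlyRegularPoints {O : Set (Cube n)} (hO : IsOpen O)
    (hc : IsPreconnected O) : IsPreconnected (O ∩ nearlyRegularPoints P) := by
  refine isPreconnected_of_locally_dense hc Set.inter_subset_left ?_ ?_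
  · exact ((dense_regularPoints (P := P)).mono regularPoints_subset).open_subset_closure_inter hO
  · intro x hx
    obtain ⟨r, hr, hb⟩ := exists_ball_preimage_subset hO hx
    refine ⟨_, Metric.isOpen_ball.preimage continuous_toReal, Metric.mem_ball_self hr, ?_⟩
    have h := isPreconnected_onAtMostOneWall (fun h hh => ne_zero_of_mem_walls (P := P) hh)
      ((Metric.isOpen_ball (x := toReal x) (ε := r)).inter isOpen_openCube)
      ((convex_ball _ _).inter convex_openCube)
    have h' : IsPreconnected (toReal ⁻¹' {y ∈ Metric.ball (toReal x) r ∩ openCube n |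
        OnAtMostOneWall (walls P) y}) := by
      apply isPreconnected_preimage_toReal
      rwa [Set.inter_eq_self_of_subset_left]
      exact fun y hy => openCube_subset_Icc hy.1.2
    convert h' using 1
    ext y
    constructor
    · rintro ⟨h1, h2, h3⟩
      exact ⟨⟨h1, h3.1⟩, h3.2⟩
    · rintro ⟨⟨h1, h2⟩, h3⟩
      exact ⟨h1, hb h1, h2, h3⟩

section Map

variable {g : Cube n → Cube n} {D : Set (Cube n)}

/-- A self-map of the cube, precomposed with the retraction of `ℝⁿ` onto the cube. -/
noncomputable def extend (g : Cube n → Cube n) (y : Fin n → ℝ) : Fin n → ℝ := toReal (g (ofReal y))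

theorem continuous_extend (hg : HasPieces P g) : Continuous (extend g) :=
  continuous_toReal.comp (hg.1.comp continuous_ofReal)

theorem injOn_extend (hinj : Set.InjOn g D) :
    Set.InjOn (extend g) (openCube n ∩ ofReal ⁻¹' D) := by
  intro y hy z hz h
  have := hinj hy.2 hz.2 (toReal_injective h)
  rw [← toReal_ofReal (openCube_subset_Icc hy.1), this, toReal_ofReal (openCube_subset_Icc hz.1)]

theorem extend_pieces (hg : HasPieces P g) {y : Fin n → ℝ} (hy : y ∈ openCube n) (i : Fin n) :
    ∃ p ∈ P, extend g y i = p y := by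
  obtain ⟨p, hp, e⟩ := hg.2 (ofReal y) i
  rw [toReal_ofReal (openCube_subset_Icc hy)] at e
  exact ⟨p, hp, e⟩

theorem HasPieces.image_mem_nhds (hg : HasPieces P g) (hD : IsOpen D) (hinj : Set.InjOn g D)
    {x : Cube n} (hx : x ∈ D) (hxP : x ∈ nearlyRegularPoints P) : g '' D ∈ 𝓝 (g x) := by
  have h := PiecewiseAffine.image_mem_nhds
    (isOpen_openCube.inter (hD.preimage continuous_ofReal)) (continuous_extend hg).continuousOn
    (injOn_extend hinj) (fun y hy i => extend_pieces hg hy.1 i)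
    (x := toReal x) ⟨hxP.1, by rwa [Set.mem_preimage, ofReal_toReal]⟩ hxP.2
  have h' := continuous_toReal.continuousAt.preimage_mem_nhds
    (show _ ∈ 𝓝 (toReal (g x)) by rwa [extend, ofReal_toReal] at h)
  refine Filter.mem_of_superset h' ?_
  rintro z ⟨y, hy, e⟩
  exact ⟨ofReal y, hy.2, toReal_injective e⟩

theorem HasPieces.volume_le (hg : HasPieces P g) (hint : ∀ p ∈ P, p ∈ Set.range intAffine)
    (hD : IsOpen D) (hinj : Set.InjOn g D) :
    volume (toReal '' D) ≤ volume (toReal '' (g '' (D ∩ regularPoints P))) := by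
  have hsub : openCube n ∩ ofReal ⁻¹' (D ∩ regularPoints P) ⊆ openCube n ∩ ofReal ⁻¹' D :=
    fun y hy => ⟨hy.1, hy.2.1⟩
  have hV := volume_le_volume_image hint
    (isOpen_openCube.inter ((hD.inter (isOpen_regularPoints (P := P))).preimage continuous_ofReal))
    (continuous_extend hg).continuousOn ((injOn_extend hinj).mono hsub)
    (fun y hy i => extend_pieces hg hy.1 i)
    (fun y hy => by simpa only [toReal_ofReal (openCube_subset_Icc hy.1)] using hy.2.2.2)
  have himg : extend g '' (openCube n ∩ ofReal ⁻¹' (D ∩ regularPoints P)) ⊆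
      toReal '' (g '' (D ∩ regularPoints P)) := by
    rintro _ ⟨y, hy, rfl⟩
    exact ⟨_, ⟨_, hy.2, rfl⟩, rfl⟩
  refine le_trans ?_ (hV.trans (measure_mono himg))
  -- what is lost lies on the walls or on the boundary of the cube
  have hae : (openCube n : Set (Fin n → ℝ)) =ᵐ[volume] Set.Icc 0 1 :=
    Measure.univ_pi_Ioo_ae_eq_Icc
  have hoff : ∀ᵐ y : Fin n → ℝ, OffWalls (walls P) y :=
    addHaar_not_offWalls volume fun h hh => ne_zero_of_mem_walls hh
  refine measure_mono_ae ?_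
  filter_upwards [hae.mem_iff, hoff] with y hy hyw
  rintro ⟨x, hx, rfl⟩
  have hxc := hy.2 (toReal_mem_Icc x)
  refine ⟨hxc, ?_⟩
  rw [Set.mem_preimage, ofReal_toReal]
  exact ⟨hx, hxc, hyw⟩

/-- Two piecewise affine sections of the same map over a connected open set coincide as soon as
they agree at one point that lies on at most one wall. The points of this kind form a connected
set, and the set of agreement is open in it: near such a point the values of one section belong to
the open image of the other. -/
theorem HasPieces.eqOn_of_leftInvOn (hg : HasPieces P g) {g' h : Cube n → Cube n}
    (hg' : HasPieces P g') {O : Set (Cube n)} (hO : IsOpen O) (hc : IsPreconnected O)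
    (hh : Set.LeftInvOn h g O) (hh' : Set.LeftInvOn h g' O) {x₀ : Cube n} (hx₀ : x₀ ∈ O)
    (hx₀P : x₀ ∈ nearlyRegularPoints P) (heq : g x₀ = g' x₀) : Set.EqOn g g' O := by
  have hpre := isPreconnected_inter_nearlyRegularPoints (P := P) hO hc
  have := isPreconnected_iff_preconnectedSpace.1 hpre
  let W := O ∩ nearlyRegularPoints P
  have hcl : IsClosed {x : W | g x = g' x} :=
    isClosed_eq (hg.1.comp continuous_subtype_val) (hg'.1.comp continuous_subtype_val)
  have hop : IsOpen {x : W | g x = g' x} := by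
    rw [isOpen_iff_mem_nhds]
    rintro ⟨x, hxO, hxP⟩ (hx : g x = g' x)
    have h1 := hg'.image_mem_nhds hO hh'.injOn hxO hxP
    rw [← hx] at h1
    have h2 := (hg.1.comp continuous_subtype_val).continuousAt.preimage_mem_nhds
      (x := (⟨x, hxO, hxP⟩ : W)) h1
    filter_upwards [h2]
    rintro ⟨y, hyO, hyP⟩ ⟨z, hz, hzy : g' z = g y⟩
    have : z = y := by rw [← hh' hz, hzy, hh hyO]
    subst this
    exact hzy.symm
  have huniv := IsClopen.eq_univ ⟨hcl, hop⟩ ⟨⟨x₀, hx₀, hx₀P⟩, heq⟩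
  have hW : Set.EqOn g g' W := fun x hx => by
    have : (⟨x, hx⟩ : W) ∈ {x : W | g x = g' x} := huniv ▸ Set.mem_univ _
    exact this
  exact (hW.closure hg.1 hg'.1).mono
    (((dense_regularPoints (P := P)).mono regularPoints_subset).open_subset_closure_inter hO)

end Map

end McNaughton

/-! ### Interiors of ranges and their components -/

namespace McNaughton

open PiecewiseAffine

variable {n : ℕ} {P : Finset ((Fin n → ℝ) →ᵃ[ℝ] ℝ)} {g : Cube n → Cube n} {D : Set (Cube n)}

/-- Injective piecewise affine maps preserve the property of being contained in the closure of the
interior: they are open at all regular points, and these are dense. -/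
theorem HasPieces.image_subset_closure_interior (hg : HasPieces P g)
    (hD : D ⊆ closure (interior D)) (hinj : Set.InjOn g D) :
    g '' D ⊆ closure (interior (g '' D)) := by
  have h1 : D ⊆ closure (interior D ∩ regularPoints P) :=
    hD.trans (closure_minimal
      ((dense_regularPoints (P := P)).open_subset_closure_inter isOpen_interior) isClosed_closure)
  refine (Set.image_mono h1).trans ((image_closure_subset_closure_image hg.1).trans
    (closure_mono ?_))
  rintro _ ⟨x, ⟨hxD, hxP⟩, rfl⟩
  rw [mem_interior_iff_mem_nhds]
  exact Filter.mem_of_superset (hg.image_mem_nhds isOpen_interior (hinj.mono interior_subset) hxD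
    (regularPoints_subset hxP)) (Set.image_mono interior_subset)

theorem isOpen_of_mem_components {U C : Set (Cube n)} (hU : IsOpen U) (hC : C ∈ components U) :
    IsOpen C := by
  obtain ⟨x, -, rfl⟩ := hC
  exact hU.connectedComponentIn

theorem isPreconnected_of_mem_components {X : Type*} [TopologicalSpace X] {U C : Set X}
    (hC : C ∈ components U) : IsPreconnected C := by
  obtain ⟨x, -, rfl⟩ := hC
  exact isPreconnected_connectedComponentIn

theorem nonempty_of_mem_components {X : Type*} [TopologicalSpace X] {U C : Set X}
    (hC : C ∈ components U) : C.Nonempty := by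
  obtain ⟨x, hx, rfl⟩ := hC
  exact ⟨x, mem_connectedComponentIn hx⟩

theorem subset_of_mem_components {X : Type*} [TopologicalSpace X] {U C : Set X}
    (hC : C ∈ components U) : C ⊆ U := by
  obtain ⟨x, hx, rfl⟩ := hC
  exact connectedComponentIn_subset _ _

theorem eq_connectedComponentIn {X : Type*} [TopologicalSpace X] {U C : Set X}
    (hC : C ∈ components U) {x : X} (hx : x ∈ C) : C = connectedComponentIn U x := by
  obtain ⟨y, hy, rfl⟩ := hC
  exact connectedComponentIn_eq hx

/-- The interior of the fixed point set of a piecewise affine map has finitely many components.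
The walls of the map, together with those where a piece equals a coordinate function, cut the
cube into finitely many convex open cells, on each of which the map is either the identity or has
no fixed point; every component contains one of the former. -/
theorem HasPieces.finite_components (hg : HasPieces P g) :
    (components (interior {x | g x = x})).Finite := by
  classical
  let coord : Fin n → (Fin n → ℝ) →ᵃ[ℝ] ℝ := fun i => (LinearMap.proj i).toAffineMap
  let P' := P ∪ Finset.univ.image coord
  have hg' : HasPieces P' g := hg.mono Finset.subset_union_left
  have hcoord : ∀ i, coord i ∈ P' := fun i =>
    Finset.mem_union_right _ (Finset.mem_image_of_mem _ (Finset.mem_univ i))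
  set U := interior {x | g x = x} with hU
  have hex : ∀ C, ∃ x, C ∈ components U → x ∈ C ∩ regularPoints P' := by
    intro C
    by_cases hC : C ∈ components U
    · obtain ⟨x, hx⟩ := (dense_regularPoints (P := P')).inter_open_nonempty C
        (isOpen_of_mem_components isOpen_interior hC) (nonempty_of_mem_components hC)
      exact ⟨x, fun _ => hx⟩
    · exact ⟨0, fun h => absurd h hC⟩
  choose c hc using hex
  refine Set.Finite.of_injOn (f := fun C => (walls P').filter fun h => 0 < h (toReal (c C)))
    (t := ((walls P').powerset : Set (Finset ((Fin n → ℝ) →ᵃ[ℝ] ℝ))))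
    (fun C _ => Finset.mem_coe.2 (Finset.mem_powerset.2 (Finset.filter_subset _ _))) ?_
    (Finset.finite_toSet _)
  intro C hC C' hC' hCC
  obtain ⟨hxC, hxc, hxw⟩ := hc C hC
  obtain ⟨hxC', hxc', hxw'⟩ := hc C' hC'
  set x := toReal (c C) with hx
  set x' := toReal (c C') with hx'
  -- the open cell of the arrangement of walls that contains `x`
  let K : Set (Fin n → ℝ) := openCube n ∩ ⋂ h ∈ walls P', {y | 0 < (h x • h) y}
  have hKo : IsOpen K := isOpen_openCube.inter (isOpen_biInter_finset fun h _ =>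
    isOpen_lt continuous_const (h x • h).continuous_of_finiteDimensional)
  have hKc : Convex ℝ K := convex_openCube.inter (convex_iInter₂ fun h _ =>
    (convex_Ioi (0 : ℝ)).affine_preimage (h x • h))
  have hxK : x ∈ K := by
    refine ⟨hxc, Set.mem_iInter₂.2 fun h hh => ?_⟩
    exact mul_self_pos.2 (hxw h hh)
  have hxK' : x' ∈ K := by
    refine ⟨hxc', Set.mem_iInter₂.2 fun h hh => ?_⟩
    have hiff : 0 < h x ↔ 0 < h x' := by
      have := Finset.ext_iff.1 hCC h
      simpa [hh] using this
    change 0 < h x * h x'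
    rcases lt_or_gt_of_ne (hxw h hh) with h1 | h1
    · have h2 : h x' < 0 := lt_of_le_of_ne (not_lt.1 fun h2 => h1.not_gt (hiff.2 h2)) (hxw' h hh)
      exact mul_pos_of_neg_of_neg h1 h2
    · exact mul_pos h1 (hiff.1 h1)
  have hKw : ∀ y ∈ K, OffWalls (walls P') y := by
    intro y hy h hh h0
    have : 0 < h x * h y := Set.mem_iInter₂.1 hy.2 h hh
    rw [h0, mul_zero] at this
    exact this.false
  have hfix : c C ∈ {x | g x = x} := interior_subset (subset_of_mem_components hC hxC)
  have hid : ∀ y ∈ K, extend g y = y := by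
    intro y hy
    funext i
    obtain ⟨p, hp, hpx, hpK⟩ := exists_eqOn_piece (f := fun y => extend g y i) P' (fun p y => p y)
      (fun p _ => p.continuous_of_finiteDimensional) hKc.isPreconnected
      ((continuous_apply i).comp (continuous_extend hg)).continuousOn
      (fun y hy => extend_pieces hg' hy.1 i)
      (fun y hy p hp q hq hpq h => hKw y hy _ (mem_walls.2 ⟨p, hp, q, hq, hpq, rfl⟩)
        (by simp [h])) hxK
    have hpc : p = coord i := by
      by_contra hne
      refine hKw x hxK _ (mem_walls.2 ⟨p, hp, _, hcoord i, hne, rfl⟩) ?_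
      have h1 : extend g x = x := by rw [extend, hx, ofReal_toReal, show g (c C) = c C from hfix]
      rw [AffineMap.coe_sub, Pi.sub_apply, ← hpx, h1]
      exact sub_self _
    rw [hpK y hy, hpc]
    rfl
  have hKU : toReal ⁻¹' K ⊆ U := by
    refine interior_maximal (fun z hz => ?_) (hKo.preimage continuous_toReal)
    have := hid _ hz
    rw [extend, ofReal_toReal] at this
    exact toReal_injective this
  have hpre : IsPreconnected (toReal ⁻¹' K) := isPreconnected_preimage_toReal
    (hKc.inter (convex_Icc _ _)).isPreconnected
  rw [eq_connectedComponentIn hC hxC, eq_connectedComponentIn hC' hxC']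
  exact connectedComponentIn_eq (hpre.subset_connectedComponentIn hxK hKU hxK')

theorem toReal_image_subset_Icc (D : Set (Cube n)) : toReal '' D ⊆ Set.Icc 0 1 :=
  Set.image_subset_iff.2 fun x _ => toReal_mem_Icc x

theorem volume_toReal_image_ne_top (D : Set (Cube n)) : volume (toReal '' D) ≠ ⊤ :=
  measure_ne_top_of_subset (toReal_image_subset_Icc D) isCompact_Icc.measure_ne_top

theorem lebesgue_pos (hD : IsOpen D) (hne : D.Nonempty) : 0 < lebesgue D := by
  obtain ⟨x, hx, hxc, -⟩ := (dense_regularPoints (P := ∅)).inter_open_nonempty D hD hne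
  have hsub : openCube n ∩ ofReal ⁻¹' D ⊆ toReal '' D := fun y hy =>
    ⟨ofReal y, hy.2, toReal_ofReal (openCube_subset_Icc hy.1)⟩
  have hpos : 0 < volume (toReal '' D) := lt_of_lt_of_le
    ((isOpen_openCube.inter (hD.preimage continuous_ofReal)).measure_pos volume
      ⟨toReal x, hxc, by rwa [Set.mem_preimage, ofReal_toReal]⟩) (measure_mono hsub)
  exact ENNReal.toReal_pos hpos.ne' (volume_toReal_image_ne_top D)

end McNaughton

/-! ### Homomorphisms as evaluations, and retractions as maps of the cube -/

namespace McNaughton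

open MVAlgebra

variable {n : ℕ}

theorem coe_oplus (a b : unitInterval) : ((oplus a b : unitInterval) : ℝ) = min 1 ((a : ℝ) + b) :=
  rfl

theorem coe_mneg (a : unitInterval) : ((mneg a : unitInterval) : ℝ) = 1 - a :=
  rfl

theorem coe_mzero : ((mzero : unitInterval) : ℝ) = 0 :=
  rfl

theorem oplus_apply (f g : McN n) (y : Cube n) : (oplus f g).1 y = oplus (f.1 y) (g.1 y) :=
  rfl

theorem mneg_apply (f : McN n) (y : Cube n) : (mneg f).1 y = mneg (f.1 y) :=
  rfl

theorem mzero_apply (y : Cube n) : (mzero : McN n).1 y = mzero :=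
  rfl

/-- An element of the kernel of a homomorphism to `[0,1]` has a zero: otherwise it is bounded away
from `0`, and a finite sum of copies of it is the constant `1`. -/
theorem exists_zero_of_map_eq_zero (h : Hom (McN n) unitInterval) {f : McN n} (hf : h f = mzero) :
    ∃ y, f.1 y = mzero := by
  by_contra! hne
  let d : ℕ → McN n := fun k => (fun f => oplus f f)^[k] f
  have hd : ∀ k y, ((d k).1 y : ℝ) = min 1 (2 ^ k * (f.1 y : ℝ)) := by
    intro k y
    induction k with
    | zero => simp [d, (f.1 y).2.2]
    | succ k ih =>
      have : d (k + 1) = oplus (d k) (d k) := Function.iterate_succ_apply' _ _ _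
      rw [this, oplus_apply, coe_oplus, ih, pow_succ]
      have h0 : (0 : ℝ) ≤ 2 ^ k * (f.1 y : ℝ) := mul_nonneg (by positivity) (f.1 y).2.1
      grind
  have hhd : ∀ k, h (d k) = mzero := by
    intro k
    induction k with
    | zero => exact hf
    | succ k ih =>
      have : d (k + 1) = oplus (d k) (d k) := Function.iterate_succ_apply' _ _ _
      rw [this, h.map_oplus, ih, oplus_mzero]
  have hcont : Continuous fun y => (f.1 y : ℝ) := continuous_subtype_val.comp f.2.1
  obtain ⟨y₀, -, hy₀⟩ := (isCompact_univ : IsCompact (Set.univ : Set (Cube n))).exists_isMinOn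
    ⟨0, trivial⟩ hcont.continuousOn
  have hpos : 0 < (f.1 y₀ : ℝ) :=
    lt_of_le_of_ne (f.1 y₀).2.1 fun h0 => hne y₀ (Subtype.ext h0.symm)
  obtain ⟨k, hk⟩ := pow_unbounded_of_one_lt (1 / (f.1 y₀ : ℝ)) one_lt_two
  have hone : d k = mneg mzero := by
    refine Subtype.ext (funext fun y => Subtype.ext ?_)
    rw [hd, mneg_apply, mzero_apply, coe_mneg, coe_mzero, sub_zero, min_eq_left]
    rw [div_lt_iff₀ hpos] at hk
    have h1 : (f.1 y₀ : ℝ) ≤ f.1 y := hy₀ (Set.mem_univ y)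
    nlinarith [pow_pos (two_pos (α := ℝ)) k]
  have := hhd k
  rw [hone, h.map_mneg, h.map_mzero] at this
  have := congrArg Subtype.val this
  rw [coe_mneg, coe_mzero] at this
  norm_num at this

/-- The elements of the kernel of a homomorphism to `[0,1]` have a common zero. -/
theorem exists_common_zero (h : Hom (McN n) unitInterval) :
    ∃ y : Cube n, ∀ f, h f = mzero → f.1 y = mzero := by
  classical
  have hfin : ∀ u : Finset {f // h f = mzero}, ∃ F, h F = mzero ∧
      ∀ y, F.1 y = mzero → ∀ f ∈ u, f.1.1 y = mzero := by
    intro u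
    induction u using Finset.induction with
    | empty => exact ⟨mzero, h.map_mzero, by simp⟩
    | insert f u _ ih =>
      obtain ⟨F, hF, hFu⟩ := ih
      refine ⟨oplus f.1 F, by rw [h.map_oplus, f.2, hF, oplus_mzero], fun y hy => ?_⟩
      have h1 := congrArg Subtype.val hy
      rw [oplus_apply, coe_oplus, coe_mzero] at h1
      have h2 := (f.1.1 y).2.1
      have h3 := (F.1 y).2.1
      have h4 : ((f.1.1 y : ℝ) + F.1 y) = 0 := by grind
      intro f' hf'
      rcases Finset.mem_insert.1 hf' with rfl | hf'
      · exact Subtype.ext (show (f'.1.1 y : ℝ) = 0 by linarith)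
      · exact hFu y (Subtype.ext (show (F.1 y : ℝ) = 0 by linarith)) f' hf'
  obtain ⟨y, -, hy⟩ := (isCompact_univ : IsCompact (Set.univ : Set (Cube n))).inter_iInter_nonempty
    (fun f : {f // h f = mzero} => {y | f.1.1 y = mzero})
    (fun f => isClosed_eq f.1.2.1 continuous_const) (by
      intro u
      obtain ⟨F, hF, hFu⟩ := hfin u
      obtain ⟨y, hy⟩ := exists_zero_of_map_eq_zero h hF
      exact ⟨y, trivial, Set.mem_iInter₂.2 fun f hf => hFu y hy f hf⟩)
  exact ⟨y, fun f hf => Set.mem_iInter.1 hy ⟨f, hf⟩⟩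

/-- If all elements of the kernel of `h` vanish at `y`, then `f y ≤ h f`: a positive gap
`f y - h f` could be doubled indefinitely by passing from `f` to `f ⊕ f` or `¬(¬f ⊕ ¬f)`. -/
theorem apply_le_of_ker_vanishes {h : Hom (McN n) unitInterval} {y : Cube n}
    (hy : ∀ f, h f = mzero → f.1 y = mzero) (f : McN n) : (f.1 y : ℝ) ≤ h f := by
  by_contra! hlt
  have key : ∀ (k : ℕ) (f : McN n), (h f : ℝ) < f.1 y → 2 ^ k * ((f.1 y : ℝ) - h f) ≤ 1 := by
    intro k
    induction k with
    | zero =>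
      intro f _
      have := (f.1 y).2.2
      have := (h f).2.1
      linarith
    | succ k ih =>
      intro f hf
      have hsq : ∀ a : unitInterval, ((mneg (oplus (mneg a) (mneg a)) : unitInterval) : ℝ) =
          max 0 (2 * (a : ℝ) - 1) := by
        intro a
        rw [coe_mneg, coe_oplus, coe_mneg]
        grind
      have hb := (f.1 y).2
      have ha := (h f).2
      rcases le_or_gt (f.1 y : ℝ) (1 / 2) with h1 | h1
      · have e1 : ((oplus f f).1 y : ℝ) = 2 * f.1 y := by
          rw [oplus_apply, coe_oplus, min_eq_right (by linarith)]; ring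
        have e2 : (h (oplus f f) : ℝ) = 2 * h f := by
          rw [h.map_oplus, coe_oplus, min_eq_right (by linarith)]; ring
        have := ih (oplus f f) (by rw [e1, e2]; linarith)
        rw [e1, e2] at this
        rw [pow_succ]
        linarith
      · have e1 : ((mneg (oplus (mneg f) (mneg f))).1 y : ℝ) = 2 * f.1 y - 1 := by
          rw [mneg_apply, oplus_apply, mneg_apply, hsq, max_eq_right (by linarith)]
        have e2 : (h (mneg (oplus (mneg f) (mneg f))) : ℝ) = max 0 (2 * (h f : ℝ) - 1) := by
          rw [h.map_mneg, h.map_oplus, h.map_mneg, hsq]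
        rcases le_or_gt (1 / 2) (h f : ℝ) with h2 | h2
        · rw [max_eq_right (by linarith)] at e2
          have := ih _ (by rw [e1, e2]; linarith)
          rw [e1, e2] at this
          rw [pow_succ]
          linarith
        · rw [max_eq_left (by linarith)] at e2
          have := congrArg Subtype.val (hy _ (Subtype.ext e2))
          rw [e1, coe_mzero] at this
          linarith
  obtain ⟨k, hk⟩ := pow_unbounded_of_one_lt (1 / ((f.1 y : ℝ) - h f)) one_lt_two
  rw [div_lt_iff₀ (sub_pos.2 hlt)] at hk
  exact absurd (key k f hlt) (not_le.2 hk)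

/-- Every homomorphism from `M([0,1]^n)` to `[0,1]` is the evaluation at a point. -/
theorem hom_eq_eval (h : Hom (McN n) unitInterval) (f : McN n) :
    h f = f.1 fun i => h (proj i) := by
  obtain ⟨y, hy⟩ := exists_common_zero h
  have hev : ∀ f, h f = f.1 y := by
    intro f
    refine Subtype.ext (le_antisymm ?_ (apply_le_of_ker_vanishes hy f))
    have := apply_le_of_ker_vanishes hy (mneg f)
    rw [mneg_apply, h.map_mneg, coe_mneg, coe_mneg] at this
    linarith
  have : (fun i => h (proj i)) = y := funext fun i => hev (proj i)
  rw [this, hev]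

theorem hom_apply (ε : Hom (McN n) (McN n)) (f : McN n) (x : Cube n) :
    (ε f).1 x = f.1 (dualMap ε x) :=
  hom_eq_eval
    { toFun := fun f => (ε f).1 x
      map_mzero := by rw [ε.map_mzero, mzero_apply]
      map_mneg := fun f => by rw [ε.map_mneg, mneg_apply]
      map_oplus := fun f g => by rw [ε.map_oplus, oplus_apply] } f

theorem dualMap_injective : Function.Injective (dualMap : Hom (McN n) (McN n) → _) := by
  intro ε δ h
  refine Hom.ext (funext fun f => Subtype.ext (funext fun x => ?_))
  rw [hom_apply, hom_apply, h]

variable {A : Subalg (McN n)} {ε δ : Hom (McN n) (McN n)}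

theorem apply_of_mem (hε : ε ∈ retractionsOnto A) {f : McN n} (hf : f ∈ A.carrier) : ε f = f := by
  rw [← hε.2] at hf
  obtain ⟨g, rfl⟩ := hf
  exact hε.1 g

theorem apply_mem (hε : ε ∈ retractionsOnto A) (f : McN n) : ε f ∈ A.carrier :=
  hε.2 ▸ Set.mem_range_self f

/-- Retractions onto the same subalgebra have dual maps with the same fibres. -/
theorem dualMap_dualMap (hε : ε ∈ retractionsOnto A) (hδ : δ ∈ retractionsOnto A) (x : Cube n) :
    dualMap δ (dualMap ε x) = dualMap δ x := by
  funext i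
  change (δ (proj i)).1 (dualMap ε x) = _
  rw [← hom_apply, apply_of_mem hε (apply_mem hδ _)]
  rfl

theorem range_dualMap (hε : ε ∈ retractionsOnto A) :
    Set.range (dualMap ε) = {x | dualMap ε x = x} := by
  ext x
  constructor
  · rintro ⟨y, rfl⟩
    exact dualMap_dualMap hε hε y
  · exact fun hx => ⟨x, hx⟩

/-- An isomorphism of `A` with `M(Q)`, for a `ℤ`-retract `Q`, is dual to a bijection of `Q` with
the range of the dual map of any retraction onto `A`, and this bijection is a `ℤ`-map. -/
theorem exists_injOn_image_eq_range (hε : ε ∈ retractionsOnto A) {Q : Set (Cube n)}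
    (hQ : IsZRetract Q) (hiso : Isomorphic A.carrier (McNOn Q)) :
    ∃ g : Cube n → Cube n, (∀ i, IsMcNaughton fun x => g x i) ∧ Set.InjOn g Q ∧
      g '' Q = Set.range (dualMap ε) := by
  obtain ⟨φ, hφi, hφs⟩ := hiso
  obtain ⟨ρ, ⟨hρM, hρ⟩, rfl⟩ := hQ
  let a : McN n → A.carrier := fun f => ⟨ε f, apply_mem hε f⟩
  have ha0 : a mzero = mzero := Subtype.ext ε.map_mzero
  have han : ∀ f, a (mneg f) = mneg (a f) := fun f => Subtype.ext (ε.map_mneg f)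
  have hap : ∀ f g, a (oplus f g) = oplus (a f) (a g) := fun f g => Subtype.ext (ε.map_oplus f g)
  have haA : ∀ b : A.carrier, a b.1 = b := fun b => Subtype.ext (apply_of_mem hε b.2)
  choose G hG using fun i => (φ (a (proj i))).2
  let g : Cube n → Cube n := fun x i => (G i).1 x
  have hg : ∀ (q : Set.range ρ) (f : McN n), (φ (a f)).1 q = f.1 (g q) := by
    intro q f
    have := hom_eq_eval (n := n)
      { toFun := fun f => (φ (a f)).1 q
        map_mzero := by rw [ha0, φ.map_mzero]; rfl
        map_mneg := fun f => by rw [han, φ.map_mneg]; rfl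
        map_oplus := fun f g => by rw [hap, φ.map_oplus]; rfl } f
    refine this.trans (congrArg f.1 (funext fun i => ?_))
    exact congrFun (hG i) q
  let r : McN n → McNOn (Set.range ρ) := fun f => ⟨_, f, rfl⟩
  -- the inverse isomorphism is dual to the inverse of `g`
  let ψ : McNOn (Set.range ρ) → A.carrier := Function.surjInv hφs
  have hφψ : ∀ b, φ (ψ b) = b := Function.surjInv_eq hφs
  have hψφ : ∀ b, ψ (φ b) = b := Function.leftInverse_surjInv ⟨hφi, hφs⟩
  have hψ0 : ψ mzero = mzero := hφi (by rw [hφψ, φ.map_mzero])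
  have hψn : ∀ b, ψ (mneg b) = mneg (ψ b) := fun b => hφi (by rw [hφψ, φ.map_mneg, hφψ])
  have hψp : ∀ b c, ψ (oplus b c) = oplus (ψ b) (ψ c) := fun b c =>
    hφi (by rw [hφψ, φ.map_oplus, hφψ, hφψ])
  let k : Cube n → Cube n := fun s i => (ψ (r (proj i))).1.1 s
  have hk : ∀ (s : Cube n) (f : McN n), (ψ (r f)).1.1 s = f.1 (k s) := by
    intro s f
    exact hom_eq_eval (n := n)
      { toFun := fun f => (ψ (r f)).1.1 s
        map_mzero := by
          change (ψ mzero).1.1 s = _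
          rw [hψ0]; rfl
        map_mneg := fun f => by
          change (ψ (mneg (r f))).1.1 s = _
          rw [hψn]; rfl
        map_oplus := fun f g => by
          change (ψ (oplus (r f) (r g))).1.1 s = _
          rw [hψp]; rfl } f
  refine ⟨g, fun i => (G i).2, ?_, ?_⟩
  · intro q hq q' hq' h
    funext i
    obtain ⟨b, hb⟩ := hφs (r (proj i))
    have h1 := hg ⟨q, hq⟩ b.1
    have h2 := hg ⟨q', hq'⟩ b.1
    rw [haA, hb] at h1 h2
    exact h1.trans ((congrArg b.1.1 h).trans h2.symm)
  · rw [range_dualMap hε]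
    apply Set.Subset.antisymm
    · rintro _ ⟨q, hq, rfl⟩
      funext i
      change (ε (proj i)).1 (g q) = _
      rw [← hg ⟨q, hq⟩ (ε (proj i)), haA (a (proj i)), hg ⟨q, hq⟩ (proj i)]
      rfl
    · intro s (hs : dualMap ε s = s)
      have hkQ : k s ∈ Set.range ρ := by
        refine ⟨k s, funext fun i => ?_⟩
        have h1 := hk s ⟨fun x => ρ x i, hρM i⟩
        have h2 : r ⟨fun x => ρ x i, hρM i⟩ = r (proj i) := by
          refine Subtype.ext (funext ?_)
          rintro ⟨_, z, rfl⟩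
          exact congrFun (hρ z) i
        rw [h2, hk] at h1
        exact h1.symm
      refine ⟨k s, hkQ, funext fun i => ?_⟩
      have h1 : φ (a (proj i)) = r (G i) := Subtype.ext (hG i)
      have h2 := hk s (G i)
      rw [← h1, hψφ] at h2
      refine h2.symm.trans ?_
      change (ε (proj i)).1 s = _
      rw [hom_apply, hs]
      rfl

end McNaughton

/-! ### Counting retractions -/

namespace McNaughton

open PiecewiseAffine MVAlgebra

/-- Suppose each `a ∈ R` is determined by its `K.card`-element family `w a b`, `b ∈ K`, of subsets
of a set of measure at most `1`, any two sets of all these families being equal or disjoint and each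
of them having measure at least `lam`. At most `⌊1 / lam⌋` different sets occur, and the elements of
`R` inject into the `K.card`-element subsets of the set of them. -/
theorem card_le_choose_of_equal_or_disjoint {α β Ω : Type*} [MeasurableSpace Ω] {μ : Measure Ω}
    {R : Finset α} {K : Finset β} {w : α → β → Set Ω} {X : Set Ω} {lam : ℝ} (hlam : 0 < lam)
    (hXtop : μ X ≠ ⊤) (hX : μ.real X ≤ 1) (hwX : ∀ a ∈ R, ∀ b ∈ K, w a b ⊆ X)
    (hmeas : ∀ a ∈ R, ∀ b ∈ K, MeasurableSet (w a b))
    (hle : ∀ a ∈ R, ∀ b ∈ K, lam ≤ μ.real (w a b))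
    (hdisj : ∀ a ∈ R, ∀ b ∈ K, ∀ a' ∈ R, ∀ b' ∈ K, (w a b ∩ w a' b').Nonempty → w a b = w a' b')
    (hinj : ∀ a ∈ R, Set.InjOn (w a) K)
    (himg : ∀ a ∈ R, ∀ a' ∈ R, w a '' K = w a' '' K → a = a') :
    R.card ≤ Nat.choose ⌊1 / lam⌋₊ K.card := by
  classical
  let 𝓕 : Finset (Set Ω) := R.biUnion fun a => K.image (w a)
  have h𝓕 : ∀ s, s ∈ 𝓕 ↔ ∃ a ∈ R, ∃ b ∈ K, w a b = s := by simp [𝓕]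
  have hsub : (⋃ s ∈ 𝓕, s) ⊆ X := by
    refine Set.iUnion₂_subset fun s hs => ?_
    obtain ⟨a, ha, b, hb, rfl⟩ := (h𝓕 s).1 hs
    exact hwX a ha b hb
  have hsum : μ.real (⋃ s ∈ 𝓕, s) = ∑ s ∈ 𝓕, μ.real s := by
    refine measureReal_biUnion_finset ?_ ?_ ?_
    · intro s hs t ht hst
      obtain ⟨a, ha, b, hb, rfl⟩ := (h𝓕 s).1 hs
      obtain ⟨a', ha', b', hb', rfl⟩ := (h𝓕 t).1 ht
      by_contra hnd
      exact hst (hdisj a ha b hb a' ha' b' hb' (Set.not_disjoint_iff_nonempty_inter.1 hnd))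
    · intro s hs
      obtain ⟨a, ha, b, hb, rfl⟩ := (h𝓕 s).1 hs
      exact hmeas a ha b hb
    · intro s hs
      obtain ⟨a, ha, b, hb, rfl⟩ := (h𝓕 s).1 hs
      exact measure_ne_top_of_subset (hwX a ha b hb) hXtop
  have hcard : (𝓕.card : ℝ) * lam ≤ 1 := by
    calc (𝓕.card : ℝ) * lam = ∑ s ∈ 𝓕, lam := by rw [Finset.sum_const, nsmul_eq_mul]
      _ ≤ ∑ s ∈ 𝓕, μ.real s := by
        refine Finset.sum_le_sum fun s hs => ?_
        obtain ⟨a, ha, b, hb, rfl⟩ := (h𝓕 s).1 hs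
        exact hle a ha b hb
      _ ≤ μ.real X := hsum ▸ measureReal_mono hsub hXtop
      _ ≤ 1 := hX
  have h1 : 𝓕.card ≤ ⌊1 / lam⌋₊ := Nat.le_floor ((le_div_iff₀ hlam).2 hcard)
  have h2 : R.card ≤ (𝓕.powersetCard K.card).card := by
    refine Finset.card_le_card_of_injOn (fun a => K.image (w a)) ?_ ?_
    · intro a ha
      refine Finset.mem_coe.2 (Finset.mem_powersetCard.2
        ⟨Finset.subset_biUnion_of_mem (fun a => K.image (w a)) ha, ?_⟩)
      exact Finset.card_image_of_injOn (hinj a ha)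
    · intro a ha a' ha' h
      refine himg a ha a' ha' ?_
      have := congrArg (fun s : Finset (Set Ω) => (s : Set (Set Ω))) h
      simpa using this
  rw [Finset.card_powersetCard] at h2
  exact h2.trans (Nat.choose_le_choose _ h1)

variable {n : ℕ} {A : Subalg (McN n)} {ε : Hom (McN n) (McN n)}

/-- The bound for a finite set `R` of retractions onto `A`. Let `S` be the range of the dual map
of `ε`. The dual maps of the members of `R` are sections over `S` of the dual map of `ε`, so that
the images of the components of the interior of `S` under them are pairwise equal or disjoint
(up to the walls of a finite set of pieces common to all of `R`), and they have at least the
measure of the component. -/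
theorem card_retractions_le (hε : ε ∈ retractionsOnto A)
    (hdense : Set.range (dualMap ε) ⊆ closure (interior (Set.range (dualMap ε))))
    {K : Finset (Set (Cube n))} (hK : ↑K = components (interior (Set.range (dualMap ε))))
    {lam : ℝ} (hlam : 0 < lam) (hleast : ∀ O ∈ K, lam ≤ lebesgue O)
    {R : Finset (Hom (McN n) (McN n))} (hR : ∀ δ ∈ R, δ ∈ retractionsOnto A) :
    R.card ≤ Nat.choose ⌊1 / lam⌋₊ K.card := by
  classical
  choose Q hQint hQ using fun δ : Hom (McN n) (McN n) =>
    exists_hasPieces (g := dualMap δ) fun i => (δ (proj i)).2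
  let P := R.biUnion Q
  have hPint : ∀ p ∈ P, p ∈ Set.range intAffine := by
    intro p hp
    obtain ⟨δ, -, hp⟩ := Finset.mem_biUnion.1 hp
    exact hQint δ p hp
  have hP : ∀ δ ∈ R, HasPieces P (dualMap δ) := fun δ hδ =>
    (hQ δ).mono (Finset.subset_biUnion_of_mem Q hδ)
  set U := interior (Set.range (dualMap ε)) with hU
  have hmem : ∀ O ∈ K, O ∈ components U := fun O hO => hK ▸ Finset.mem_coe.2 hO
  have hfix : ∀ x ∈ U, dualMap ε x = x := fun x hx => by
    have := interior_subset hx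
    rwa [range_dualMap hε] at this
  have hsec : ∀ δ ∈ R, Set.LeftInvOn (dualMap ε) (dualMap δ) U := fun δ hδ x hx => by
    rw [dualMap_dualMap (hR δ hδ) hε, hfix x hx]
  have hOU : ∀ O ∈ K, O ⊆ U := fun O hO => subset_of_mem_components (hmem O hO)
  have hopen : ∀ O ∈ K, IsOpen O := fun O hO =>
    isOpen_of_mem_components isOpen_interior (hmem O hO)
  have heq : ∀ O ∈ K, ∀ O' ∈ K, ∀ x ∈ O, x ∈ O' → O = O' := fun O hO O' hO' x hx hx' =>
    (eq_connectedComponentIn (hmem O hO) hx).trans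
      (eq_connectedComponentIn (hmem O' hO') hx').symm
  -- a common point of two images comes from the same point of the same component
  have hmeet : ∀ δ ∈ R, ∀ O ∈ K, ∀ δ' ∈ R, ∀ O' ∈ K, ∀ x ∈ O ∩ regularPoints P,
      ∀ x' ∈ O' ∩ regularPoints P, dualMap δ x = dualMap δ' x' →
      O = O' ∧ Set.EqOn (dualMap δ) (dualMap δ') O := by
    intro δ hδ O hO δ' hδ' O' hO' x hx x' hx' h
    have hxx : x = x' := by
      rw [← hsec δ hδ (hOU O hO hx.1), h, hsec δ' hδ' (hOU O' hO' hx'.1)]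
    subst hxx
    exact ⟨heq O hO O' hO' x hx.1 hx'.1, (hP δ hδ).eqOn_of_leftInvOn (hP δ' hδ') (hopen O hO)
      (isPreconnected_of_mem_components (hmem O hO)) ((hsec δ hδ).mono (hOU O hO))
      ((hsec δ' hδ').mono (hOU O hO)) hx.1 (regularPoints_subset hx.2) h⟩
  let w : Hom (McN n) (McN n) → Set (Cube n) → Set (Fin n → ℝ) := fun δ O =>
    toReal '' (dualMap δ '' (O ∩ regularPoints P))
  have hwmeet : ∀ δ ∈ R, ∀ O ∈ K, ∀ δ' ∈ R, ∀ O' ∈ K, (w δ O ∩ w δ' O').Nonempty →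
      O = O' ∧ Set.EqOn (dualMap δ) (dualMap δ') O := by
    rintro δ hδ O hO δ' hδ' O' hO' ⟨_, ⟨_, ⟨x, hx, rfl⟩, rfl⟩, ⟨_, ⟨x', hx', rfl⟩, e⟩⟩
    exact hmeet δ hδ O hO δ' hδ' O' hO' x hx x' hx' (toReal_injective e).symm
  have hwne : ∀ δ, ∀ O ∈ K, (w δ O).Nonempty := fun δ O hO =>
    ((dense_regularPoints.inter_open_nonempty O (hopen O hO)
      (nonempty_of_mem_components (hmem O hO))).image _).image _
  refine card_le_choose_of_equal_or_disjoint (μ := volume) (w := w) (X := Set.Icc 0 1) hlam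
    isCompact_Icc.measure_ne_top ?_ (fun δ _ O _ => toReal_image_subset_Icc _) ?_ ?_ ?_ ?_ ?_
  · simp [measureReal_def, Real.volume_Icc_pi]
  · intro δ hδ O hO
    change MeasurableSet (toReal '' (dualMap δ '' (O ∩ regularPoints P)))
    rw [← Set.image_comp]
    refine ((hopen O hO).inter isOpen_regularPoints).measurableSet.image_of_continuousOn_injOn
      (continuous_toReal.comp (hP δ hδ).1).continuousOn ?_
    exact toReal_injective.comp_injOn
      ((hsec δ hδ).injOn.mono (Set.inter_subset_left.trans (hOU O hO)))
  · intro δ hδ O hO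
    exact (hleast O hO).trans (ENNReal.toReal_mono (volume_toReal_image_ne_top _)
      ((hP δ hδ).volume_le hPint (hopen O hO) ((hsec δ hδ).injOn.mono (hOU O hO))))
  · intro δ hδ O hO δ' hδ' O' hO' h
    obtain ⟨rfl, hE⟩ := hwmeet δ hδ O hO δ' hδ' O' hO' h
    exact congrArg (toReal '' ·) (hE.mono Set.inter_subset_left).image_eq
  · intro δ hδ O hO O' hO' h
    exact (hwmeet δ hδ O hO δ hδ O' hO' ⟨_, (hwne δ O hO).some_mem, h ▸ (hwne δ O hO).some_mem⟩).1
  · intro δ hδ δ' hδ' h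
    have hUeq : Set.EqOn (dualMap δ) (dualMap δ') U := by
      intro x hx
      have hO : connectedComponentIn U x ∈ K := by
        rw [← Finset.mem_coe, hK]
        exact ⟨x, hx, rfl⟩
      obtain ⟨O', hO', e⟩ : w δ (connectedComponentIn U x) ∈ w δ' '' K :=
        h ▸ Set.mem_image_of_mem _ hO
      obtain ⟨z, hz⟩ := hwne δ _ hO
      exact (hwmeet δ hδ _ hO δ' hδ' O' hO' ⟨z, hz, e ▸ hz⟩).2 (mem_connectedComponentIn hx)
    apply dualMap_injective
    funext x
    rw [← dualMap_dualMap hε (hR δ hδ), ← dualMap_dualMap hε (hR δ' hδ')]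
    exact hUeq.closure (hP δ hδ).1 (hP δ' hδ').1 (hdense ⟨x, rfl⟩)

theorem range_subset_closure_interior (hε : ε ∈ retractionsOnto A)
    (hdom : MaxSpecIsClosedDomain n A.carrier) :
    Set.range (dualMap ε) ⊆ closure (interior (Set.range (dualMap ε))) := by
  obtain ⟨Q, hQ, hiso, hcd⟩ := hdom
  obtain ⟨g, hg, hinj, himg⟩ := exists_injOn_image_eq_range hε hQ hiso
  obtain ⟨P, -, hP⟩ := exists_hasPieces hg
  rw [← himg]
  exact hP.image_subset_closure_interior (hcd : closure (interior Q) = Q).ge hinj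

end McNaughton

theorem mainTheorem2 (n : ℕ) (hn : 1 ≤ n) (A : MVAlgebra.Subalg (McNaughton.McN n))
    (hA : McNaughton.IsRetract A) (hdom : McNaughton.MaxSpecIsClosedDomain n A.carrier) :
    (McNaughton.retractionsOnto A).Finite ∧
    ∀ ε ∈ McNaughton.retractionsOnto A,
      (McNaughton.components (interior (Set.range (McNaughton.dualMap ε)))).Finite ∧
      ∃ lam : ℝ, 0 < lam ∧
        IsLeast (McNaughton.lebesgue ''
          McNaughton.components (interior (Set.range (McNaughton.dualMap ε)))) lam ∧
        (McNaughton.retractionsOnto A).ncard ≤ Nat.choose ⌊1 / lam⌋₊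
          (McNaughton.components (interior (Set.range (McNaughton.dualMap ε)))).ncard := by
  have key : ∀ ε ∈ McNaughton.retractionsOnto A,
      (McNaughton.components (interior (Set.range (McNaughton.dualMap ε)))).Finite ∧
      ∃ lam : ℝ, 0 < lam ∧
        IsLeast (McNaughton.lebesgue ''
          McNaughton.components (interior (Set.range (McNaughton.dualMap ε)))) lam ∧
        ∀ R : Finset (MVAlgebra.Hom (McNaughton.McN n) (McNaughton.McN n)),
          ↑R ⊆ McNaughton.retractionsOnto A → R.card ≤ Nat.choose ⌊1 / lam⌋₊
          (McNaughton.components (interior (Set.range (McNaughton.dualMap ε)))).ncard := by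
    intro ε hε
    have hdense := McNaughton.range_subset_closure_interior hε hdom
    have hfin : (McNaughton.components (interior (Set.range (McNaughton.dualMap ε)))).Finite := by
      obtain ⟨P, -, hP⟩ := McNaughton.exists_hasPieces (g := McNaughton.dualMap ε)
        fun i => (ε (McNaughton.proj i)).2
      rw [McNaughton.range_dualMap hε]
      exact hP.finite_components
    have hne : (McNaughton.components (interior (Set.range (McNaughton.dualMap ε)))).Nonempty := by
      obtain ⟨x, hx⟩ := closure_nonempty_iff.1 ⟨_, hdense ⟨0, rfl⟩⟩
      exact ⟨_, x, hx, rfl⟩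
    obtain ⟨O, hO, hmin⟩ := Set.exists_min_image _ McNaughton.lebesgue hfin hne
    have hpos : 0 < McNaughton.lebesgue O := McNaughton.lebesgue_pos
      (McNaughton.isOpen_of_mem_components isOpen_interior hO)
      (McNaughton.nonempty_of_mem_components hO)
    refine ⟨hfin, _, hpos, ⟨⟨O, hO, rfl⟩, ?_⟩, fun R hR => ?_⟩
    · rintro _ ⟨O', hO', rfl⟩
      exact hmin O' hO'
    · rw [Set.ncard_eq_toFinset_card _ hfin]
      exact McNaughton.card_retractions_le hε hdense hfin.coe_toFinset hpos
        (fun O' hO' => hmin O' (hfin.mem_toFinset.1 hO')) hR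
  have hfinite : (McNaughton.retractionsOnto A).Finite := by
    obtain ⟨ε, hε⟩ := hA
    obtain ⟨-, lam, -, -, hR⟩ := key ε hε
    by_contra hinf
    obtain ⟨R, hRA, hcard⟩ := Set.Infinite.exists_subset_card_eq hinf
      (Nat.choose ⌊1 / lam⌋₊
        (McNaughton.components (interior (Set.range (McNaughton.dualMap ε)))).ncard + 1)
    have := hR R hRA
    omega
  refine ⟨hfinite, fun ε hε => ?_⟩
  obtain ⟨hfin, lam, hlam, hleast, hR⟩ := key ε hε
  refine ⟨hfin, lam, hlam, hleast, ?_⟩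
  rw [Set.ncard_eq_toFinset_card _ hfinite]
  exact hR _ hfinite.coe_toFinset.subset
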